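/- Let $P$ and $Q$ be probability measures on a common measurable space. Let $\mu$ be a measure dominating both (e.g. $\mu=P+Q$), $p=\frac{dP}{d\mu}$, $q=\frac{dQ}{d\mu}$. Logarithms are to an arbitrary fixed base larger than $1$, with $\log 0=-\infty$, $\log\infty=\infty$. The relative information is $\imath_{P\|Q}=\log p-\log q$, and the relative information spectrum is $F(x)=\mathbb{F}_{P\|Q}(x)=P[\imath_{P\|Q}\le x]$, $x\in\mathbb{R}$. For convex $f\colon(0,\infty)\to\mathbb{R}$ with $f(1)=0$, let $D_f(P\|Q)=\int q\,f(p/q)\,d\mu$, where $f(0)=\lim_{t\downarrow 0}f(t)$, $0f(0/0)=0$, $0f(a/0)=a\lim_{u\to\infty}f(u)/u$ for $a>0$. All identities below are between extended real numbers, with $0\cdot\infty=0$. The identities marked $(\ast)$ are asserted if $Q\ll P$; all others hold for all $P,Q$. 1. Relative entropy $D$ (that is, $D_f$ with $f(t)=t\log t$): $$\tfrac{1}{\log e}D(P\|Q)=\int_1^\infty\frac{1-F(\log\beta)}{\beta}\,d\beta-\int_0^1\frac{F(\log\beta)}{\beta}\,d\beta.$$ 2. Hellinger divergence $\mathscr{H}_\alpha=D_{f_\alpha}$,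 $f_\alpha(t)=\frac{t^\alpha-1}{\alpha-1}$: $$\mathscr{H}_\alpha(P\|Q)=\frac1{1-\alpha}-\int_0^\infty\beta^{\alpha-2}F(\log\beta)\,d\beta\quad(0<\alpha<1),$$ $$\mathscr{H}_\alpha(P\|Q)=\int_0^\infty\beta^{\alpha-2}(1-F(\log\beta))\,d\beta-\frac1{\alpha-1}\quad(\alpha>1).$$ In particular, for the chi-squared divergence $\chi^2=D_f$ with $f(t)=(t-1)^2$, the squared Hellinger distance $\mathscr{H}^2=\frac12\mathscr{H}_{1/2}$ and the Bhattacharyya distance $B=\log\frac1{1-\mathscr{H}^2}$, $$\chi^2(P\|Q)=\int_0^\infty(1-F(\log\beta))\,d\beta-1,\qquad \mathscr{H}^2(P\|Q)=1-\tfrac12\int_0^\infty\beta^{-3/2}F(\log\beta)\,d\beta,$$ $$B(P\|Q)=\log2-\log\Bigl(\int_0^\infty\beta^{-3/2}F(\log\beta)\,d\beta\Bigr).$$ 3. Rényi divergence $D_\alpha=\frac1{\alpha-1}\log(1+(\alpha-1)\mathscr{H}_\alpha)$: $$D_\alpha(P\|Q)=\tfrac1{\alpha-1}\log\Bigl((1-\alpha)\int_0^\infty\beta^{\alpha-2}F(\log\beta)\,d\beta\Bigr)\quad(0<\alpha<1),$$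 $$D_\alpha(P\|Q)=\tfrac1{\alpha-1}\log\Bigl((\alpha-1)\int_0^\infty\beta^{\alpha-2}(1-F(\log\beta))\,d\beta\Bigr)\quad(\alpha>1).$$ 4. $\chi^s$ divergence $\chi^s=D_{f_s}$, $f_s(t)=|t-1|^s$, for $s\ge1$: $$(\ast)\quad\chi^s(P\|Q)=\int_1^\infty\tfrac1\beta\bigl(s-1+\tfrac1\beta\bigr)(\beta-1)^{s-1}(1-F(\log\beta))\,d\beta+\int_0^1\tfrac1\beta\bigl(s-1+\tfrac1\beta\bigr)(1-\beta)^{s-1}F(\log\beta)\,d\beta.$$ For the total variation distance $|P-Q|=D_{f_1}(P\|Q)$: $$|P-Q|=2\int_1^\infty\frac{1-F(\log\beta)}{\beta^2}\,d\beta,\qquad(\ast)\quad|P-Q|=2\int_0^1\frac{F(\log\beta)}{\beta^2}\,d\beta.$$ 5. DeGroot statistical information $\mathcal{I}_w=D_{\phi_w}$, $\phi_w(t)=\min\{w,1-w\}-\min\{wt,1-w\}$: $$(\ast)\quad\mathcal{I}_w(P\|Q)=(1-w)\int_0^{\frac{1-w}{w}}\frac{F(\log\beta)}{\beta^2}\,d\beta\quad(\tfrac12<w<1),$$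 $$\mathcal{I}_w(P\|Q)=(1-w)\int_{\frac{1-w}{w}}^\infty\frac{1-F(\log\beta)}{\beta^2}\,d\beta\quad(0<w\le\tfrac12).$$ 6. Triangular discrimination $\Delta=D_f$, $f(t)=\frac{(t-1)^2}{t+1}$: $$\Delta(P\|Q)=4\int_0^\infty\frac{1-F(\log\beta)}{(\beta+1)^2}\,d\beta-2.$$ 7. Lin's measure $L_\theta(P\|Q)=\theta D(P\|\theta P+(1-\theta)Q)+(1-\theta)D(Q\|\theta P+(1-\theta)Q)$, for $\theta\in[0,1]$, with $h$ the binary entropy function: $$L_\theta(P\|Q)=h(\theta)-(1-\theta)\int_0^\infty\frac{\log\bigl(1+\frac{\theta\beta}{1-\theta}\bigr)}{\beta^2}F(\log\beta)\,d\beta,$$ the last term being $0$ for $\theta=1$. For the Jensen–Shannon divergence $\mathrm{JS}=L_{1/2}$: $$\mathrm{JS}(P\|Q)=\log2-\int_0^\infty\frac{\log(\beta+1)}{2\beta^2}F(\log\beta)\,d\beta.$$ 8. Jeffreys' divergence $J(P\|Q)=D(P\|Q)+D(Q\|P)$: $$(\ast)\quad J(P\|Q)=\int_1^\infty(1-F(\log\beta))\Bigl(\frac{\log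 e}\beta+\frac{\log\beta}{\beta^2}\Bigr)d\beta-\int_0^1F(\log\beta)\Bigl(\frac{\log e}\beta+\frac{\log\beta}{\beta^2}\Bigr)d\beta.$$ 9. $E_\gamma$ divergence $E_\gamma(P\|Q)=\max_U(P(U)-\gamma Q(U))$ (maximum over events $U$), for $\gamma\ge1$: $$E_\gamma(P\|Q)=\gamma\int_\gamma^\infty\frac{1-F(\log\beta)}{\beta^2}\,d\beta.$$ -/

import Mathlib

open MeasureTheory Set Filter Topology
open scoped ENNReal

noncomputable section

namespace RelInfo

/-- The extended-real Lebesgue integral `∫ g⁺ dμ - ∫ g⁻ dμ` of an extended-real function.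
It is the usual integral as soon as one of the two parts is finite. -/
def extIntegral {A : Type*} [MeasurableSpace A] (μ : Measure A) (g : A → EReal) : EReal :=
  ((∫⁻ a, (g a).toENNReal ∂μ : ℝ≥0∞) : EReal) - ((∫⁻ a, (-(g a)).toENNReal ∂μ : ℝ≥0∞) : EReal)

/-- The integral `∫_s g(β) dβ`, as an extended real number, of a real function over `s ⊆ ℝ`
with respect to Lebesgue measure. -/
def intOn (s : Set ℝ) (g : ℝ → ℝ) : EReal :=
  extIntegral (volume.restrict s) (fun β => (g β : EReal))

/-- The logarithm to the base `b` on `[0, ∞]`, with `log 0 = -∞` and `log ∞ = ∞`. -/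
def elogb (b : ℝ) (x : ℝ≥0∞) : EReal := ENNReal.log x / ((Real.log b : ℝ) : EReal)

/-- The value `f(0) = lim_{t ↓ 0} f(t)`. -/
def atZero (f : ℝ → ℝ) : EReal := limUnder (𝓝[>] (0 : ℝ)) (fun t => (f t : EReal))

/-- The value `f*(0) = lim_{u → ∞} f(u) / u`. -/
def slopeAtTop (f : ℝ → ℝ) : EReal := limUnder atTop (fun u : ℝ => ((f u / u : ℝ) : EReal))

/-- The integrand `q f(p/q)` for `p, q ≥ 0`, with the conventions `0 f(0/0) = 0` and
`0 f(p/0) = p lim_{u → ∞} f(u)/u`. -/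
def perspective (f : ℝ → ℝ) (p q : ℝ) : EReal :=
  if 0 < q then
    if 0 < p then ((q * f (p / q) : ℝ) : EReal) else (q : EReal) * atZero f
  else
    if 0 < p then (p : EReal) * slopeAtTop f else 0

variable {A : Type*} [MeasurableSpace A]

/-- The `f`-divergence `D_f(P‖Q) = ∫ q f(p/q) dμ`, for the dominating measure `μ = P + Q`. -/
def fDiv (f : ℝ → ℝ) (P Q : Measure A) : EReal :=
  extIntegral (P + Q) fun a =>
    perspective f (P.rnDeriv (P + Q) a).toReal (Q.rnDeriv (P + Q) a).toReal

/-- The relative information `log (dP/dμ) - log (dQ/dμ)` to the base `b`, for the dominating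
measure `μ = P + Q`. -/
def relInfo (b : ℝ) (P Q : Measure A) (a : A) : EReal :=
  elogb b (P.rnDeriv (P + Q) a) - elogb b (Q.rnDeriv (P + Q) a)

/-- The relative information spectrum: the distribution function of the relative information
under `P`. -/
def spectrumRI (b : ℝ) (P Q : Measure A) (x : ℝ) : ℝ :=
  P.real {a | relInfo b P Q a ≤ (x : EReal)}

/-- Relative entropy, with logarithms to the base `b`. -/
def relEntropy (b : ℝ) (P Q : Measure A) : EReal :=
  (InformationTheory.klDiv P Q : EReal) / ((Real.log b : ℝ) : EReal)

/-- Jeffreys' divergence. -/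
def jeffreys (b : ℝ) (P Q : Measure A) : EReal := relEntropy b P Q + relEntropy b Q P

/-- The Hellinger divergence of order `α`. -/
def hellinger (α : ℝ) (P Q : Measure A) : EReal := fDiv (fun t => (t ^ α - 1) / (α - 1)) P Q

/-- The chi-squared divergence. -/
def chiSq (P Q : Measure A) : EReal := fDiv (fun t => (t - 1) ^ 2) P Q

/-- The squared Hellinger distance. -/
def sqHellinger (P Q : Measure A) : EReal := ((1 / 2 : ℝ) : EReal) * hellinger (1 / 2) P Q

/-- The Bhattacharyya distance `log (1 / (1 - H²))`. -/
def bhattacharyya (b : ℝ) (P Q : Measure A) : EReal :=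
  elogb b ((1 - sqHellinger P Q).toENNReal)⁻¹

/-- The Rényi divergence of order `α`. -/
def renyi (b α : ℝ) (P Q : Measure A) : EReal :=
  ((1 / (α - 1) : ℝ) : EReal) *
    elogb b ((1 + ((α - 1 : ℝ) : EReal) * hellinger α P Q).toENNReal)

/-- The `χ^s` divergence. -/
def chiPow (s : ℝ) (P Q : Measure A) : EReal := fDiv (fun t => |t - 1| ^ s) P Q

/-- The total variation distance, with the normalization `|P - Q| = ∫ |p - q| dμ`. -/
def tvDist (P Q : Measure A) : EReal := fDiv (fun t => |t - 1|) P Q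

/-- The DeGroot statistical information. -/
def deGroot (w : ℝ) (P Q : Measure A) : EReal :=
  fDiv (fun t => min w (1 - w) - min (w * t) (1 - w)) P Q

/-- Triangular discrimination. -/
def triangular (P Q : Measure A) : EReal := fDiv (fun t => (t - 1) ^ 2 / (t + 1)) P Q

/-- The mixture `θ P + (1 - θ) Q`. -/
def mixture (θ : ℝ) (P Q : Measure A) : Measure A :=
  ENNReal.ofReal θ • P + ENNReal.ofReal (1 - θ) • Q

/-- Lin's measure. -/
def lin (b θ : ℝ) (P Q : Measure A) : EReal :=
  (θ : EReal) * relEntropy b P (mixture θ P Q) +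
    ((1 - θ : ℝ) : EReal) * relEntropy b Q (mixture θ P Q)

/-- The Jensen-Shannon divergence. -/
def jensenShannon (b : ℝ) (P Q : Measure A) : EReal := lin b (1 / 2) P Q

/-- The `E_γ` divergence: the maximum of `P(U) - γ Q(U)` over the events `U`. -/
def eGamma (γ : ℝ) (P Q : Measure A) : ℝ :=
  sSup {x : ℝ | ∃ U : Set A, MeasurableSet U ∧ x = P.real U - γ * Q.real U}

end RelInfo

end

open RelInfo

/-! Up to an affine term, an `f`-divergence is a mean under `P` of a function of the likelihood
ratio, and such a mean is read off the distribution function by the layer cake formula. Write f(t) =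
t K(t) + c t + d with K ≥ 0. Since p and q integrate to one, ∫ q f(p/q) dμ = ∫ p K(p/q) dμ + c + d.
If K increases from K(k) = 0, then K(r) is the integral of K' over (k, r), and Tonelli turns ∫ p
K(p/q) into ∫ K'(β) P[p > βq] dβ, where P[p > βq] = 1 - F(log β). If K decreases to 0, the same
computation gives ∫ -K'(β) F(log β) dβ. Each identity thus comes from a decomposition of f and a
primitive: `lintegral_tail`, `lintegral_head` and `intOn_halfLine` are the layer cake formulas,
while `fDiv_eq_lintegral_weight_add` and `fDiv_eq_sub_lintegral_weight` handle f.

The degenerate points explain the hypotheses. Where q = 0 < p, K takes its limit at ∞, possibly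
infinite. Where p = 0 < q, the decomposition requires f(0) = d; this fails when t K(t) does not tend
to 0 at the origin, and then `Q ≪ P` makes the event null.

Relative entropy enters through the nonnegative kernel of t log t + 1 - t. The identities for D,
Jeffreys' divergence and Lin's measure come from pointwise identities between kernels, written with
sums in `ℝ≥0∞` and turned into extended-real differences only once the subtracted terms are known to
be finite. For E_γ the maximizing event {p ≥ γq} is explicit. -/

namespace RelInfo

/-! ### Extended-real integrals -/

section ExtendedIntegral

variable {A : Type*} [MeasurableSpace A] {μ : Measure A}

/-- Passage from subtraction-free identities to extended-real differences. With `n`, `a`, `c`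
finite, the only infinite case is x = y = ∞. -/
lemma coe_sub_coe_eq_of_add_eq {x n y a c : ℝ≥0∞} (h : x + c = n + y + a)
    (hn : n ≠ ∞) (ha : a ≠ ∞) (hc : c ≠ ∞) :
    (x : EReal) - n = y + ((a.toReal - c.toReal : ℝ) : EReal) := by
  lift n to NNReal using hn
  lift a to NNReal using ha
  lift c to NNReal using hc
  induction y using ENNReal.recTopCoe with
  | top =>
    have hx : x = ∞ := by
      simp only [add_top, top_add, ENNReal.add_eq_top, ENNReal.coe_ne_top, or_false] at h
      exact h
    subst hx
    rw [EReal.coe_ennreal_top, EReal.top_add_coe]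
    exact EReal.top_sub_coe _
  | coe y =>
    have hx : x ≠ ∞ := by
      rintro rfl
      simp only [top_add] at h
      exact absurd h.symm (by finiteness)
    lift x to NNReal using hx
    have h' : (x : ℝ) + c = n + y + a := by exact_mod_cast h
    have : (x : ℝ) - n = y + (a - c) := by linarith
    have e := congrArg Real.toEReal this
    simp only [EReal.coe_sub, EReal.coe_add] at e
    exact e

/-- This is x⁺ - x⁻ = y + z⁺ - z⁻ with the negative parts moved across, so that it can be integrated
in `ℝ≥0∞`. -/
lemma toENNReal_add_ofReal {x : EReal} {y : ℝ≥0∞} {z : ℝ} (h : x = y + (z : EReal)) :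
    x.toENNReal + ENNReal.ofReal (-z) = (-x).toENNReal + (y + ENNReal.ofReal z) := by
  subst h
  induction y using ENNReal.recTopCoe with
  | top => simp
  | coe y =>
    have e : ((y : ℝ≥0∞) : EReal) + (z : EReal) = ((y + z : ℝ) : EReal) := by simp; rfl
    rw [e, ← EReal.coe_neg, EReal.real_coe_toENNReal, EReal.real_coe_toENNReal]
    have : (y : ℝ≥0∞) = ENNReal.ofReal y := by simp
    have hy : (0 : ℝ) ≤ y := y.2
    rw [this, ← ENNReal.toReal_eq_toReal_iff' (by finiteness) (by finiteness),
      ENNReal.toReal_add (by finiteness) (by finiteness),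
      ENNReal.toReal_add (by finiteness) (by finiteness),
      ENNReal.toReal_add (by finiteness) (by finiteness)]
    simp only [ENNReal.toReal_ofReal', max_def]
    split_ifs <;> linarith

lemma extIntegral_eq_lintegral_add {X : A → EReal} {Y : A → ℝ≥0∞} {Z : A → ℝ}
    (hY : Measurable Y) (hZm : Measurable Z) (hZ : Integrable Z μ)
    (h : ∀ᵐ a ∂μ, X a = (Y a : EReal) + (Z a : EReal)) :
    extIntegral μ X = ((∫⁻ a, Y a ∂μ : ℝ≥0∞) : EReal) + ((∫ a, Z a ∂μ : ℝ) : EReal) := by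
  have hsum : (∫⁻ a, (X a).toENNReal ∂μ) + ∫⁻ a, ENNReal.ofReal (-Z a) ∂μ =
      (∫⁻ a, (-(X a)).toENNReal ∂μ) + (∫⁻ a, Y a ∂μ) + ∫⁻ a, ENNReal.ofReal (Z a) ∂μ := by
    rw [← lintegral_add_right _ (g := fun a => ENNReal.ofReal (-Z a)) hZm.neg.ennreal_ofReal, add_assoc, ← lintegral_add_left hY,
      ← lintegral_add_right _ (g := fun a => Y a + ENNReal.ofReal (Z a)) (hY.add hZm.ennreal_ofReal)]
    exact lintegral_congr_ae (h.mono fun a ha => toENNReal_add_ofReal ha)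
  have hc : ∫⁻ a, ENNReal.ofReal (-Z a) ∂μ ≠ ∞ := hZ.neg.lintegral_lt_top.ne
  rw [integral_eq_lintegral_pos_part_sub_lintegral_neg_part hZ]
  refine coe_sub_coe_eq_of_add_eq hsum ?_ hZ.lintegral_lt_top.ne hc
  -- Since Y ≥ 0, the negative part of X is at most that of the integrable Z.
  refine ne_top_of_le_ne_top hc (lintegral_mono_ae (h.mono fun a ha => ?_))
  rw [← EReal.real_coe_toENNReal]
  refine EReal.toENNReal_le_toENNReal ?_
  rw [ha, EReal.coe_neg, EReal.neg_le_neg_iff]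
  exact le_add_of_nonneg_left (EReal.coe_ennreal_nonneg _)

/-- Finiteness of one part is needed because ⊤ - ⊤ = ⊥ in `EReal`, which negation does not preserve.
-/
lemma extIntegral_neg_of_ne_top {X : A → EReal} (h : ∫⁻ a, (-(X a)).toENNReal ∂μ ≠ ∞) :
    extIntegral μ (fun a => -(X a)) = -extIntegral μ X := by
  unfold extIntegral
  simp only [neg_neg]
  rw [EReal.neg_sub (Or.inl (EReal.coe_ennreal_ne_bot _)) (Or.inr (by simpa using h)), add_comm]
  rfl

lemma intOn_eq_lintegral {S : Set ℝ} (hS : MeasurableSet S) {g : ℝ → ℝ}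
    (hg : ∀ β ∈ S, 0 ≤ g β) : intOn S g = ((∫⁻ β in S, ENNReal.ofReal (g β) : ℝ≥0∞) : EReal) := by
  unfold intOn extIntegral
  have : ∫⁻ β in S, (-((g β : ℝ) : EReal)).toENNReal = 0 := by
    rw [setLIntegral_congr_fun (g := fun _ => 0) hS]
    · simp
    · intro β hβ
      change ENNReal.ofReal (-g β) = 0
      exact ENNReal.ofReal_of_nonpos (by linarith [hg β hβ])
  rw [this]
  simp

lemma intOn_congr {S : Set ℝ} (hS : MeasurableSet S) {g g' : ℝ → ℝ}
    (h : ∀ β ∈ S, g β = g' β) : intOn S g = intOn S g' := by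
  unfold intOn extIntegral
  congr 2 <;> exact setLIntegral_congr_fun hS fun β hβ => by simp only [h β hβ]

lemma coe_mul_sub {c : ℝ} (hc : 0 ≤ c) (x y : EReal) :
    (c : EReal) * (x - y) = c * x - c * y :=
  EReal.mul_sub_of_nonneg_of_ne_top (by exact_mod_cast hc) (EReal.coe_ne_top c)

lemma intOn_const_mul {S : Set ℝ} {c : ℝ} (hc : 0 < c) (g : ℝ → ℝ) :
    intOn S (fun β => c * g β) = (c : EReal) * intOn S g := by
  have key (h : ℝ → ℝ) : ((∫⁻ β in S, ENNReal.ofReal (c * h β) : ℝ≥0∞) : EReal) =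
      c * ((∫⁻ β in S, ENNReal.ofReal (h β) : ℝ≥0∞) : EReal) := by
    simp_rw [ENNReal.ofReal_mul hc.le]
    rw [lintegral_const_mul' _ _ ENNReal.ofReal_ne_top, EReal.coe_ennreal_mul,
      EReal.coe_ennreal_ofReal, max_eq_left hc.le]
  change ((∫⁻ β in S, ENNReal.ofReal (c * g β) : ℝ≥0∞) : EReal) -
    ((∫⁻ β in S, ENNReal.ofReal (-(c * g β)) : ℝ≥0∞) : EReal) =
    c * (((∫⁻ β in S, ENNReal.ofReal (g β) : ℝ≥0∞) : EReal) -
    ((∫⁻ β in S, ENNReal.ofReal (-g β) : ℝ≥0∞) : EReal))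
  rw [coe_mul_sub hc.le, ← key g, ← key (fun β => -g β)]
  simp_rw [mul_neg]

end ExtendedIntegral

/-! ### Real densities and Tonelli for sections -/

section Density

variable {A : Type*} [MeasurableSpace A]

/-- `p` is a nonnegative real density of `P` with respect to `μ`. -/
structure IsDensity (P μ : Measure A) (p : A → ℝ) : Prop where
  measurable : Measurable p
  nonneg : ∀ a, 0 ≤ p a
  eq_withDensity : P = μ.withDensity fun a => ENNReal.ofReal (p a)

lemma isDensity_rnDeriv {P μ : Measure A} [IsFiniteMeasure P] [SigmaFinite μ] (h : P ≪ μ) :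
    IsDensity P μ fun a => (P.rnDeriv μ a).toReal where
  measurable := (Measure.measurable_rnDeriv P μ).ennreal_toReal
  nonneg _ := ENNReal.toReal_nonneg
  eq_withDensity := by
    conv_lhs => rw [← Measure.withDensity_rnDeriv_eq P μ h]
    refine withDensity_congr_ae ((Measure.rnDeriv_ne_top P μ).mono fun a ha => ?_)
    exact (ENNReal.ofReal_toReal ha).symm

namespace IsDensity

variable {P Q μ : Measure A} {p q : A → ℝ}

lemma measurable_ofReal (h : IsDensity P μ p) : Measurable fun a => ENNReal.ofReal (p a) :=
  h.measurable.ennreal_ofReal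

lemma lintegral (h : IsDensity P μ p) {f : A → ℝ≥0∞} (hf : Measurable f) :
    ∫⁻ a, f a ∂P = ∫⁻ a, ENNReal.ofReal (p a) * f a ∂μ := by
  rw [h.eq_withDensity, lintegral_withDensity_eq_lintegral_mul _ h.measurable_ofReal hf]
  rfl

lemma apply (h : IsDensity P μ p) {s : Set A} (hs : MeasurableSet s) :
    P s = ∫⁻ a in s, ENNReal.ofReal (p a) ∂μ := by
  rw [h.eq_withDensity, withDensity_apply _ hs]

lemma lintegral_eq (h : IsDensity P μ p) : ∫⁻ a, ENNReal.ofReal (p a) ∂μ = P univ := by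
  rw [h.apply MeasurableSet.univ, setLIntegral_univ]

lemma integrable [IsFiniteMeasure P] (h : IsDensity P μ p) : Integrable p μ := by
  refine ⟨h.measurable.aestronglyMeasurable, ?_⟩
  rw [hasFiniteIntegral_iff_ofReal (Eventually.of_forall h.nonneg), h.lintegral_eq]
  exact measure_lt_top P univ

lemma integral_eq_one [IsProbabilityMeasure P] (h : IsDensity P μ p) : ∫ a, p a ∂μ = 1 := by
  rw [integral_eq_lintegral_of_nonneg_ae (Eventually.of_forall h.nonneg)
    h.measurable.aestronglyMeasurable, h.lintegral_eq]
  simp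

lemma lintegral_eq_one [IsProbabilityMeasure P] (h : IsDensity P μ p) :
    ∫⁻ a, ENNReal.ofReal (p a) ∂μ = 1 := by
  rw [h.lintegral_eq, measure_univ]

lemma ae_pos (h : IsDensity P μ p) : ∀ᵐ a ∂P, 0 < p a := by
  rw [h.eq_withDensity, ae_withDensity_iff h.measurable_ofReal]
  refine Eventually.of_forall fun a ha => ?_
  simpa using ha

/-- If `Q ≪ P` then the density of `Q` vanishes where the density of `P` does. -/
lemma ae_eq_zero_of_ac (h : IsDensity P μ p) (h' : IsDensity Q μ q) (hQP : Q ≪ P) :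
    ∀ᵐ a ∂μ, p a = 0 → q a = 0 := by
  have : ∀ᵐ a ∂Q, 0 < p a := hQP.ae_le h.ae_pos
  rw [h'.eq_withDensity, ae_withDensity_iff h'.measurable_ofReal] at this
  filter_upwards [this] with a ha hp
  by_contra hq
  have := ha (by simpa using lt_of_le_of_ne (h'.nonneg a) (Ne.symm hq))
  linarith

/-- Tonelli's theorem for an integral of the probabilities of the sections of a set. -/
lemma lintegral_mul_section [IsFiniteMeasure P] [SFinite μ] (h : IsDensity P μ p)
    (S : Set ℝ) {g : ℝ → ℝ} (hg : Measurable g)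
    {E : ℝ → Set A} (hE : MeasurableSet {x : ℝ × A | x.2 ∈ E x.1}) :
    ∫⁻ β in S, ENNReal.ofReal (g β * P.real (E β)) =
      ∫⁻ a, ENNReal.ofReal (p a) *
        (∫⁻ β in S ∩ {β | a ∈ E β}, ENNReal.ofReal (g β)) ∂μ := by
  have hEβ (β : ℝ) : MeasurableSet (E β) := hE.preimage (measurable_prodMk_left (x := β))
  have hEa (a : A) : MeasurableSet {β | a ∈ E β} :=
    hE.preimage (measurable_prodMk_right (y := a))
  have hind : Measurable fun x : ℝ × A =>
      {x : ℝ × A | x.2 ∈ E x.1}.indicator (fun _ => (1 : ℝ≥0∞)) x :=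
    measurable_const.indicator hE
  have e1 (β : ℝ) : ENNReal.ofReal (g β * P.real (E β)) =
      ∫⁻ a, ENNReal.ofReal (g β) * (ENNReal.ofReal (p a) *
        {x : ℝ × A | x.2 ∈ E x.1}.indicator (fun _ => (1 : ℝ≥0∞)) (β, a)) ∂μ := by
    -- Nonnegativity of the probability suffices to split the product, so `g` may have any sign.
    rw [ENNReal.ofReal_mul' measureReal_nonneg, ofReal_measureReal,
      lintegral_const_mul' _ _ ENNReal.ofReal_ne_top, h.apply (hEβ β),
      ← lintegral_indicator (hEβ β)]
    congr 2 with a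
    by_cases ha : a ∈ E β <;> simp [ha]
  simp_rw [e1]
  rw [lintegral_lintegral_swap]
  · refine lintegral_congr fun a => ?_
    rw [Set.inter_comm, ← Measure.restrict_restrict (hEa a), ← lintegral_indicator (hEa a),
      ← lintegral_const_mul' _ _ ENNReal.ofReal_ne_top]
    refine lintegral_congr fun β => ?_
    by_cases ha : a ∈ E β <;> simp [ha, mul_comm]
  · exact ((hg.comp measurable_fst).ennreal_ofReal.mul
      ((h.measurable_ofReal.comp measurable_snd).mul hind)).aemeasurable

end IsDensity

end Density

/-! ### The spectrum as a linear inequality between densities -/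

section Spectrum

variable {A : Type*} [MeasurableSpace A]

/-- The linear form also covers y = 0: the left side is then ⊤ and both inequalities are false. -/
lemma elogb_sub_le_iff {b : ℝ} (hb : 1 < b) {x y : ℝ≥0∞} (hx : 0 < x.toReal) (hy : y ≠ ∞)
    {β : ℝ} (hβ : 0 < β) :
    elogb b x - elogb b y ≤ ((Real.logb b β : ℝ) : EReal) ↔ x.toReal ≤ β * y.toReal := by
  have hlb : 0 < Real.log b := Real.log_pos hb
  have ex : elogb b x = ((Real.log x.toReal / Real.log b : ℝ) : EReal) := by
    rw [elogb, ENNReal.log_pos_real' hx, EReal.coe_div]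
  rcases eq_or_ne y 0 with rfl | hy0
  · have e0 : elogb b 0 = ⊥ := by
      rw [elogb, ENNReal.log_zero]
      exact EReal.bot_div_of_pos_ne_top (by exact_mod_cast hlb) (EReal.coe_ne_top _)
    rw [e0, ex, EReal.coe_sub_bot]
    simp [hx]
  · have hy' : 0 < y.toReal := ENNReal.toReal_pos hy0 hy
    have ey : elogb b y = ((Real.log y.toReal / Real.log b : ℝ) : EReal) := by
      rw [elogb, ENNReal.log_pos_real' hy', EReal.coe_div]
    rw [ex, ey, ← EReal.coe_sub, EReal.coe_le_coe_iff, Real.logb, ← sub_div,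
      div_le_div_iff_of_pos_right hlb, ← Real.log_div hx.ne' hy'.ne',
      Real.log_le_log_iff (div_pos hx hy') hβ, div_le_iff₀ hy']

lemma spectrumRI_logb (P Q : Measure A) [IsProbabilityMeasure P] [IsProbabilityMeasure Q]
    {b : ℝ} (hb : 1 < b) {β : ℝ} (hβ : 0 < β) :
    spectrumRI b P Q (Real.logb b β) =
      P.real {a | (P.rnDeriv (P + Q) a).toReal ≤ β * (Q.rnDeriv (P + Q) a).toReal} := by
  have hP : P ≪ P + Q := Measure.AbsolutelyContinuous.rfl.add_right Q
  refine measureReal_congr ?_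
  filter_upwards [(isDensity_rnDeriv hP).ae_pos,
    hP.ae_le (Measure.rnDeriv_ne_top Q (P + Q))] with a ha hq
  exact propext (elogb_sub_le_iff hb ha hq hβ)

end Spectrum

/-! ### Fundamental theorem of calculus for nonnegative derivatives -/

section FundamentalTheorem

lemma lintegral_Ioc_deriv {g G : ℝ → ℝ} {a b : ℝ} (hab : a ≤ b) (hG : ContinuousOn G (Icc a b))
    (hG' : ∀ x ∈ Ioo a b, HasDerivAt G (g x) x) (hg : ∀ x ∈ Ioo a b, 0 ≤ g x) :
    ∫⁻ x in Ioc a b, ENNReal.ofReal (g x) = ENNReal.ofReal (G b - G a) := by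
  have hint := intervalIntegral.integrableOn_deriv_of_nonneg hG hG' hg
  rw [← intervalIntegral.integral_eq_sub_of_hasDerivAt_of_le hab hG hG'
    ((intervalIntegrable_iff_integrableOn_Ioc_of_le hab).2 hint),
    intervalIntegral.integral_of_le hab, ofReal_integral_eq_lintegral_ofReal hint]
  rw [← Measure.restrict_congr_set Ioo_ae_eq_Ioc]
  exact (ae_restrict_mem measurableSet_Ioo).mono hg

/-- Exhaustion by bounded intervals. Since L may be ∞, integrability is not assumed. -/
lemma lintegral_Ioi_deriv {g G : ℝ → ℝ} {a : ℝ} {L : ℝ≥0∞} (hG : ContinuousOn G (Ici a))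
    (hG' : ∀ x ∈ Ioi a, HasDerivAt G (g x) x) (hg : ∀ x ∈ Ioi a, 0 ≤ g x)
    (hL : Tendsto (fun x => ENNReal.ofReal (G x - G a)) atTop (𝓝 L)) (hgm : Measurable g) :
    ∫⁻ x in Ioi a, ENNReal.ofReal (g x) = L := by
  have h1 : AECover (volume.restrict (Ioi a)) atTop fun b : ℝ => Iic b :=
    (aecover_Iic tendsto_id).restrict
  have h2 := h1.lintegral_tendsto_of_countably_generated
    (f := fun x => ENNReal.ofReal (g x)) hgm.ennreal_ofReal.aemeasurable
  refine tendsto_nhds_unique h2 (hL.congr' ?_)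
  filter_upwards [eventually_ge_atTop a] with b hb
  rw [Measure.restrict_restrict measurableSet_Iic, Iic_inter_Ioi,
    lintegral_Ioc_deriv hb (hG.mono Icc_subset_Ici_self) (fun x hx => hG' x hx.1)
      fun x hx => hg x hx.1]

end FundamentalTheorem

/-! ### The integrand p K(p/q) -/

section Weight

/-- The integrand `x K(x/y)`, for `x, y ≥ 0`, where `L` stands for the value of `K` at `∞`. -/
noncomputable def weight (K : ℝ → ℝ) (L : ℝ≥0∞) (x y : ℝ) : ℝ≥0∞ :=
  ENNReal.ofReal x * if 0 < y then ENNReal.ofReal (K (x / y)) else L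

variable {A : Type*} [MeasurableSpace A]

lemma measurable_weight {K : ℝ → ℝ} (hK : Measurable K) (L : ℝ≥0∞) {p q : A → ℝ}
    (hp : Measurable p) (hq : Measurable q) : Measurable fun a => weight K L (p a) (q a) := by
  unfold weight
  exact hp.ennreal_ofReal.mul (Measurable.ite (measurableSet_lt measurable_const hq)
    (hK.comp (hp.div hq)).ennreal_ofReal measurable_const)

lemma measurable_comp_max {G : ℝ → ℝ} (hG : Measurable G) (c : ℝ) :
    Measurable fun t => G (max c t) := hG.comp (measurable_const.max measurable_id)

lemma measurable_comp_min {G : ℝ → ℝ} (hG : Measurable G) (c : ℝ) :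
    Measurable fun t => G (min c t) := hG.comp (measurable_const.min measurable_id)

end Weight

/-! ### Layer cake formulas -/

section Spectrum

variable {A : Type*} [MeasurableSpace A]

lemma spectrumRI_nonneg (P Q : Measure A) (b x : ℝ) : 0 ≤ spectrumRI b P Q x :=
  measureReal_nonneg

lemma spectrumRI_le_one (P Q : Measure A) [IsProbabilityMeasure P] (b x : ℝ) :
    spectrumRI b P Q x ≤ 1 := measureReal_le_one

/-- The density of `P` with respect to `P + Q`. -/
noncomputable abbrev dens₁ (P Q : Measure A) (a : A) : ℝ := (P.rnDeriv (P + Q) a).toReal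

/-- The density of `Q` with respect to `P + Q`. -/
noncomputable abbrev dens₂ (P Q : Measure A) (a : A) : ℝ := (Q.rnDeriv (P + Q) a).toReal

variable (P Q : Measure A) [IsProbabilityMeasure P] [IsProbabilityMeasure Q]

lemma isDensity₁ : IsDensity P (P + Q) (dens₁ P Q) :=
  isDensity_rnDeriv (Measure.AbsolutelyContinuous.rfl.add_right Q)

lemma isDensity₂ : IsDensity Q (P + Q) (dens₂ P Q) :=
  isDensity_rnDeriv (by rw [add_comm]; exact Measure.AbsolutelyContinuous.rfl.add_right P)

lemma measurableSet_dens_le :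
    MeasurableSet {x : ℝ × A | x.2 ∈ {a | dens₁ P Q a ≤ x.1 * dens₂ P Q a}} :=
  measurableSet_le ((isDensity₁ P Q).measurable.comp measurable_snd)
    (measurable_fst.mul ((isDensity₂ P Q).measurable.comp measurable_snd))

lemma measurableSet_lt_dens :
    MeasurableSet {x : ℝ × A | x.2 ∈ {a | x.1 * dens₂ P Q a < dens₁ P Q a}} :=
  measurableSet_lt (measurable_fst.mul ((isDensity₂ P Q).measurable.comp measurable_snd))
    ((isDensity₁ P Q).measurable.comp measurable_snd)

lemma one_sub_spectrumRI_logb {b : ℝ} (hb : 1 < b) {β : ℝ} (hβ : 0 < β) :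
    1 - spectrumRI b P Q (Real.logb b β) =
      P.real {a | β * dens₂ P Q a < dens₁ P Q a} := by
  have hm : MeasurableSet {a | dens₁ P Q a ≤ β * dens₂ P Q a} :=
    measurableSet_le (isDensity₁ P Q).measurable ((isDensity₂ P Q).measurable.const_mul β)
  rw [spectrumRI_logb P Q hb hβ, ← probReal_compl_eq_one_sub hm]
  congr 1
  ext a
  simp

/-- Layer cake formula for the upper tail of the spectrum. -/
theorem lintegral_tail {b : ℝ} (hb : 1 < b) {c : ℝ} (hc : 0 ≤ c) {g G : ℝ → ℝ} {L : ℝ≥0∞} (hgm : Measurable g)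
    (hG : ContinuousOn G (Ici c)) (hG' : ∀ x ∈ Ioi c, HasDerivAt G (g x) x)
    (hg : ∀ x ∈ Ioi c, 0 ≤ g x) (hGc : G c = 0)
    (hL : Tendsto (fun x => ENNReal.ofReal (G x)) atTop (𝓝 L)) :
    ∫⁻ β in Ioi c, ENNReal.ofReal (g β * (1 - spectrumRI b P Q (Real.logb b β))) =
      ∫⁻ a, weight (fun t => G (max c t)) L (dens₁ P Q a) (dens₂ P Q a) ∂(P + Q) := by
  have e : ∀ β ∈ Ioi c, ENNReal.ofReal (g β * (1 - spectrumRI b P Q (Real.logb b β))) =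
      ENNReal.ofReal (g β * P.real {a | β * dens₂ P Q a < dens₁ P Q a}) := fun β hβ => by
    rw [one_sub_spectrumRI_logb P Q hb (hc.trans_lt hβ)]
  rw [setLIntegral_congr_fun measurableSet_Ioi e,
    (isDensity₁ P Q).lintegral_mul_section (Ioi c) hgm (measurableSet_lt_dens P Q)]
  refine lintegral_congr fun a => ?_
  unfold weight
  have hp := (isDensity₁ P Q).nonneg a
  have hq := (isDensity₂ P Q).nonneg a
  rcases hp.eq_or_lt with hp | hp
  · simp [← hp]
  congr 1
  simp only [mem_ofPred_eq]
  split_ifs with hq'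
  · have hs : Ioi c ∩ {β | β * dens₂ P Q a < dens₁ P Q a} =
        Ioo c (dens₁ P Q a / dens₂ P Q a) := by
      ext β
      simp [lt_div_iff₀ hq']
    -- When the ratio is at most c both intervals are empty; the maximum spares a case distinction.
    have hs' : Ioo c (dens₁ P Q a / dens₂ P Q a) = Ioo c (max c (dens₁ P Q a / dens₂ P Q a)) := by
      ext β
      simp only [mem_Ioo, lt_max_iff]
      exact ⟨fun h => ⟨h.1, Or.inr h.2⟩, fun h => ⟨h.1, h.2.resolve_left h.1.not_gt⟩⟩
    rw [hs, hs', Measure.restrict_congr_set Ioo_ae_eq_Ioc,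
      lintegral_Ioc_deriv (le_max_left _ _) (hG.mono Icc_subset_Ici_self)
        (fun x hx => hG' x hx.1) (fun x hx => hg x hx.1), hGc, sub_zero]
  -- An infinite ratio exceeds every β, so the section is the whole half-line and yields the limit
  -- L.
  · have hq0 : dens₂ P Q a = 0 := le_antisymm (not_lt.1 hq') hq
    have hs : Ioi c ∩ {β | β * dens₂ P Q a < dens₁ P Q a} = Ioi c := by
      ext β
      simp [hq0, hp]
    rw [hs]
    exact lintegral_Ioi_deriv hG hG' hg (by simpa [hGc] using hL) hgm

theorem intOn_tail {b : ℝ} (hb : 1 < b) {c : ℝ} (hc : 0 ≤ c) {g G : ℝ → ℝ} {L : ℝ≥0∞} (hgm : Measurable g)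
    (hG : ContinuousOn G (Ici c)) (hG' : ∀ x ∈ Ioi c, HasDerivAt G (g x) x)
    (hg : ∀ x ∈ Ioi c, 0 ≤ g x) (hGc : G c = 0)
    (hL : Tendsto (fun x => ENNReal.ofReal (G x)) atTop (𝓝 L)) :
    intOn (Ioi c) (fun β => g β * (1 - spectrumRI b P Q (Real.logb b β))) =
      ((∫⁻ a, weight (fun t => G (max c t)) L (dens₁ P Q a) (dens₂ P Q a) ∂(P + Q) : ℝ≥0∞) :
        EReal) := by
  rw [← lintegral_tail P Q hb hc hgm hG hG' hg hGc hL]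
  exact intOn_eq_lintegral measurableSet_Ioi fun β hβ =>
    mul_nonneg (hg β hβ) (sub_nonneg.2 (spectrumRI_le_one P Q b _))

/-- Layer cake formula for the spectrum on a bounded interval. -/
theorem lintegral_head {b : ℝ} (hb : 1 < b) {c : ℝ} {g G : ℝ → ℝ} (hgm : Measurable g)
    (hG' : ∀ x ∈ Ioc 0 c, HasDerivAt G (-g x) x)
    (hg : ∀ x ∈ Ioo 0 c, 0 ≤ g x) (hGc : G c = 0) :
    ∫⁻ β in Ioo 0 c, ENNReal.ofReal (g β * spectrumRI b P Q (Real.logb b β)) =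
      ∫⁻ a, weight (fun t => G (min c t)) 0 (dens₁ P Q a) (dens₂ P Q a) ∂(P + Q) := by
  have e : ∀ β ∈ Ioo 0 c, ENNReal.ofReal (g β * spectrumRI b P Q (Real.logb b β)) =
      ENNReal.ofReal (g β * P.real {a | dens₁ P Q a ≤ β * dens₂ P Q a}) := fun β hβ => by
    rw [spectrumRI_logb P Q hb hβ.1]
  rw [setLIntegral_congr_fun measurableSet_Ioo e,
    (isDensity₁ P Q).lintegral_mul_section (Ioo 0 c) hgm (measurableSet_dens_le P Q)]
  refine lintegral_congr fun a => ?_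
  unfold weight
  have hp := (isDensity₁ P Q).nonneg a
  have hq := (isDensity₂ P Q).nonneg a
  rcases hp.eq_or_lt with hp | hp
  · simp [← hp]
  congr 1
  simp only [mem_ofPred_eq]
  split_ifs with hq'
  · have hr : 0 < dens₁ P Q a / dens₂ P Q a := div_pos hp hq'
    set r := dens₁ P Q a / dens₂ P Q a with hrdef
    have hs : Ioo 0 c ∩ {β | dens₁ P Q a ≤ β * dens₂ P Q a} = Ico r c := by
      ext β
      simp only [mem_inter_iff, mem_Ioo, mem_ofPred_eq, mem_Ico, ← div_le_iff₀ hq', ← hrdef]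
      exact ⟨fun h => ⟨h.2, h.1.2⟩, fun h => ⟨⟨hr.trans_le h.1, h.2⟩, h.1⟩⟩
    rw [hs, Measure.restrict_congr_set Ico_ae_eq_Ioc]
    rcases le_total c r with h | h
    · rw [Ioc_eq_empty (not_lt.2 h), min_eq_left h, hGc]
      simp
    · rw [min_eq_right h, lintegral_Ioc_deriv (G := fun x => -G x) h]
      · simp [hGc]
      · exact fun x hx => (hG' x ⟨hr.trans_le hx.1, hx.2⟩).continuousAt.neg.continuousWithinAt
      · intro x hx
        rw [← neg_neg (g x)]
        exact (hG' x ⟨hr.trans hx.1, hx.2.le⟩).neg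
      · exact fun x hx => hg x ⟨hr.trans hx.1, hx.2⟩
  -- An infinite ratio lies below no β, which is why the value at ∞ is 0 here.
  · have hq0 : dens₂ P Q a = 0 := le_antisymm (not_lt.1 hq') hq
    have hs : Ioo 0 c ∩ {β | dens₁ P Q a ≤ β * dens₂ P Q a} = ∅ := by
      ext β
      simp [hq0, hp]
    simp [hs]

theorem intOn_head {b : ℝ} (hb : 1 < b) {c : ℝ} {g G : ℝ → ℝ} (hgm : Measurable g)
    (hG' : ∀ x ∈ Ioc 0 c, HasDerivAt G (-g x) x)
    (hg : ∀ x ∈ Ioo 0 c, 0 ≤ g x) (hGc : G c = 0) :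
    intOn (Ioo 0 c) (fun β => g β * spectrumRI b P Q (Real.logb b β)) =
      ((∫⁻ a, weight (fun t => G (min c t)) 0 (dens₁ P Q a) (dens₂ P Q a) ∂(P + Q) : ℝ≥0∞) :
        EReal) := by
  rw [← lintegral_head P Q hb hgm hG' hg hGc]
  exact intOn_eq_lintegral measurableSet_Ioo fun β hβ =>
    mul_nonneg (hg β hβ) (spectrumRI_nonneg P Q b _)

/-- Layer cake formula for the spectrum on the half-line. -/
theorem intOn_halfLine {b : ℝ} (hb : 1 < b) {g G : ℝ → ℝ} (hgm : Measurable g)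
    (hG' : ∀ x ∈ Ioi 0, HasDerivAt G (-g x) x)
    (hg : ∀ x ∈ Ioi 0, 0 ≤ g x) (hL : Tendsto G atTop (𝓝 0)) :
    intOn (Ioi 0) (fun β => g β * spectrumRI b P Q (Real.logb b β)) =
      ((∫⁻ a, weight G 0 (dens₁ P Q a) (dens₂ P Q a) ∂(P + Q) : ℝ≥0∞) : EReal) := by
  rw [intOn_eq_lintegral measurableSet_Ioi fun β hβ =>
    mul_nonneg (hg β hβ) (spectrumRI_nonneg P Q b _)]
  have e : ∀ β ∈ Ioi 0, ENNReal.ofReal (g β * spectrumRI b P Q (Real.logb b β)) =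
      ENNReal.ofReal (g β * P.real {a | dens₁ P Q a ≤ β * dens₂ P Q a}) := fun β hβ => by
    rw [spectrumRI_logb P Q hb hβ]
  rw [setLIntegral_congr_fun measurableSet_Ioi e,
    (isDensity₁ P Q).lintegral_mul_section (Ioi 0) hgm (measurableSet_dens_le P Q)]
  congr 1
  refine lintegral_congr fun a => ?_
  unfold weight
  have hp := (isDensity₁ P Q).nonneg a
  have hq := (isDensity₂ P Q).nonneg a
  rcases hp.eq_or_lt with hp | hp
  · simp [← hp]
  congr 1
  simp only [mem_ofPred_eq]
  split_ifs with hq'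
  · have hr : 0 < dens₁ P Q a / dens₂ P Q a := div_pos hp hq'
    set r := dens₁ P Q a / dens₂ P Q a with hrdef
    have hs : Ioi 0 ∩ {β | dens₁ P Q a ≤ β * dens₂ P Q a} = Ici r := by
      ext β
      simp only [mem_inter_iff, mem_Ioi, mem_ofPred_eq, mem_Ici, ← div_le_iff₀ hq', ← hrdef]
      exact ⟨fun h => h.2, fun h => ⟨hr.trans_le h, h⟩⟩
    rw [hs, Measure.restrict_congr_set Ioi_ae_eq_Ici.symm]
    -- The increasing primitive -G tends to 0, so its total increase from r is G(r).
    refine lintegral_Ioi_deriv (G := fun x => -G x) ?_ ?_ ?_ ?_ hgm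
    · exact fun x hx => (hG' x (hr.trans_le hx)).continuousAt.neg.continuousWithinAt
    · intro x hx
      rw [← neg_neg (g x)]
      exact (hG' x (hr.trans hx)).neg
    · exact fun x hx => hg x (hr.trans hx)
    · have := (hL.neg.sub_const (-G r))
      simpa using ENNReal.tendsto_ofReal this
  · have hq0 : dens₂ P Q a = 0 := le_antisymm (not_lt.1 hq') hq
    have hs : Ioi 0 ∩ {β | dens₁ P Q a ≤ β * dens₂ P Q a} = ∅ := by
      ext β
      simp [hq0, hp]
    simp [hs]

end Spectrum

/-! ### `f`-divergences as weighted integrals -/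

section Perspective

lemma atZero_eq {f : ℝ → ℝ} {d : ℝ} (h : Tendsto f (𝓝[>] 0) (𝓝 d)) : atZero f = d :=
  (((continuous_coe_real_ereal.tendsto d).comp h)).limUnder_eq

lemma slopeAtTop_eq {f K : ℝ → ℝ} {c d : ℝ} {L : ℝ≥0∞} (hK : ∀ t, 0 < t → 0 ≤ K t)
    (hf : ∀ t, 0 < t → f t = t * K t + c * t + d)
    (hL : Tendsto (fun t => ENNReal.ofReal (K t)) atTop (𝓝 L)) :
    slopeAtTop f = (L : EReal) + c := by
  refine Tendsto.limUnder_eq ?_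
  have h1 : Tendsto (fun t => ((ENNReal.ofReal (K t) : ℝ≥0∞) : EReal)) atTop (𝓝 (L : EReal)) :=
    (continuous_coe_ennreal_ereal.tendsto L).comp hL
  have h2 : Tendsto (fun t : ℝ => ((c + d / t : ℝ) : EReal)) atTop (𝓝 (c : EReal)) := by
    refine (continuous_coe_real_ereal.tendsto c).comp ?_
    simpa using (tendsto_id.const_div_atTop d).const_add c
  have h3 : Tendsto (fun t => ((ENNReal.ofReal (K t) : ℝ≥0∞) : EReal) + ((c + d / t : ℝ) : EReal))
      atTop (𝓝 ((L : EReal) + c)) :=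
    (EReal.continuousAt_add (p := ((L : EReal), (c : EReal))) (Or.inr (EReal.coe_ne_bot _))
      (Or.inr (EReal.coe_ne_top _))).tendsto.comp (h1.prodMk_nhds h2)
  refine h3.congr' ?_
  filter_upwards [eventually_gt_atTop 0] with t ht
  rw [EReal.coe_ennreal_ofReal, max_eq_left (hK t ht), ← EReal.coe_add, hf t ht]
  congr 1
  field_simp
  ring

/-- For x, y > 0 this is y f(x/y) expanded. At y = 0 < x the slope at infinity is L + c. At x = 0 <
y the value is y f(0), hence the alternative in `h0`. -/
lemma perspective_eq_weight_add {f K : ℝ → ℝ} {c d : ℝ} {L : ℝ≥0∞}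
    (hK : ∀ t, 0 < t → 0 ≤ K t) (hf : ∀ t, 0 < t → f t = t * K t + c * t + d)
    (hL : Tendsto (fun t => ENNReal.ofReal (K t)) atTop (𝓝 L)) {x y : ℝ} (hx : 0 ≤ x)
    (hy : 0 ≤ y) (h0 : Tendsto f (𝓝[>] 0) (𝓝 d) ∨ (x = 0 → y = 0)) :
    perspective f x y = (weight K L x y : EReal) + ((c * x + d * y : ℝ) : EReal) := by
  unfold perspective weight
  rcases hy.eq_or_lt with rfl | hy
  · rcases hx.eq_or_lt with rfl | hx
    · simp
    · rw [if_neg (lt_irrefl _), if_neg (lt_irrefl _), if_pos hx, slopeAtTop_eq hK hf hL,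
        EReal.coe_ennreal_mul, EReal.coe_ennreal_ofReal, max_eq_left hx.le,
        EReal.left_distrib_of_nonneg_of_ne_top (by exact_mod_cast hx.le) (EReal.coe_ne_top _)]
      congr 1
      rw [← EReal.coe_mul]
      congr 1
      ring
  · rw [if_pos hy, if_pos hy]
    rcases hx.eq_or_lt with rfl | hx
    · rw [if_neg (lt_irrefl _), atZero_eq (h0.resolve_right fun h => hy.ne' (h rfl))]
      simp only [ENNReal.ofReal_zero, zero_mul, mul_zero, zero_add, EReal.coe_ennreal_zero]
      rw [mul_comm, EReal.coe_mul]
    · have ht := div_pos hx hy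
      rw [if_pos hx, hf _ ht, ← ENNReal.ofReal_mul hx.le, EReal.coe_ennreal_ofReal,
        max_eq_left (mul_nonneg hx.le (hK _ ht)), ← EReal.coe_add]
      congr 1
      field_simp
      ring

variable {A : Type*} [MeasurableSpace A] (P Q : Measure A) [IsProbabilityMeasure P]
  [IsProbabilityMeasure Q]

lemma integrable_dens_add (c d : ℝ) :
    Integrable (fun a => c * dens₁ P Q a + d * dens₂ P Q a) (P + Q) :=
  ((isDensity₁ P Q).integrable.const_mul c).add ((isDensity₂ P Q).integrable.const_mul d)

lemma integral_dens_add (c d : ℝ) :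
    ∫ a, (c * dens₁ P Q a + d * dens₂ P Q a) ∂(P + Q) = c + d := by
  rw [integral_add ((isDensity₁ P Q).integrable.const_mul c)
    ((isDensity₂ P Q).integrable.const_mul d), integral_const_mul, integral_const_mul,
    (isDensity₁ P Q).integral_eq_one, (isDensity₂ P Q).integral_eq_one, mul_one, mul_one]

lemma measurable_dens_add (c d : ℝ) :
    Measurable fun a => c * dens₁ P Q a + d * dens₂ P Q a :=
  ((isDensity₁ P Q).measurable.const_mul c).add ((isDensity₂ P Q).measurable.const_mul d)

/-- An `f`-divergence in terms of `K(t)` where `f(t) = t K(t) + c t + d`. -/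
theorem fDiv_eq_lintegral_weight_add {f K : ℝ → ℝ} {c d : ℝ} {L : ℝ≥0∞} (hKm : Measurable K)
    (hK : ∀ t, 0 < t → 0 ≤ K t) (hf : ∀ t, 0 < t → f t = t * K t + c * t + d)
    (hL : Tendsto (fun t => ENNReal.ofReal (K t)) atTop (𝓝 L))
    (h0 : Tendsto f (𝓝[>] 0) (𝓝 d) ∨ Q ≪ P) :
    fDiv f P Q = ((∫⁻ a, weight K L (dens₁ P Q a) (dens₂ P Q a) ∂(P + Q) : ℝ≥0∞) : EReal) +
      ((c + d : ℝ) : EReal) := by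
  rw [← integral_dens_add P Q c d]
  refine extIntegral_eq_lintegral_add
    (measurable_weight hKm L (isDensity₁ P Q).measurable (isDensity₂ P Q).measurable)
    (measurable_dens_add P Q c d) (integrable_dens_add P Q c d) ?_
  rcases h0 with h0 | h0
  · exact Eventually.of_forall fun a => perspective_eq_weight_add hK hf hL
      ((isDensity₁ P Q).nonneg a) ((isDensity₂ P Q).nonneg a) (Or.inl h0)
  · filter_upwards [(isDensity₁ P Q).ae_eq_zero_of_ac (isDensity₂ P Q) h0] with a ha
    exact perspective_eq_weight_add hK hf hL ((isDensity₁ P Q).nonneg a)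
      ((isDensity₂ P Q).nonneg a) (Or.inr ha)

/-- An `f`-divergence in terms of `K(t)` where `f(t) = d - t K(t)`. -/
theorem fDiv_eq_sub_lintegral_weight {f K : ℝ → ℝ} {d : ℝ} (hKm : Measurable K)
    (hd : 0 ≤ d) (hK : ∀ t, 0 < t → 0 ≤ K t) (hf : ∀ t, 0 < t → f t = d - t * K t)
    (hL : Tendsto K atTop (𝓝 0)) (h0 : Tendsto f (𝓝[>] 0) (𝓝 d)) :
    fDiv f P Q = (d : EReal) -
      ((∫⁻ a, weight K 0 (dens₁ P Q a) (dens₂ P Q a) ∂(P + Q) : ℝ≥0∞) : EReal) := by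
  have hs : slopeAtTop f = 0 := by
    refine Tendsto.limUnder_eq ?_
    refine (continuous_coe_real_ereal.tendsto 0).comp ?_
    have := (tendsto_id.const_div_atTop d).sub hL
    rw [sub_zero] at this
    refine this.congr' ?_
    filter_upwards [eventually_gt_atTop 0] with t ht
    rw [hf t ht, id]
    field_simp
  -- It is -f, not f, that is a nonnegative term plus an integrable one; the sign is reversed after
  -- integration.
  have key (x y : ℝ) (hx : 0 ≤ x) (hy : 0 ≤ y) :
      -perspective f x y = (weight K 0 x y : EReal) + ((0 * x + -d * y : ℝ) : EReal) := by
    unfold perspective weight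
    rcases hy.eq_or_lt with rfl | hy
    · simp [hs]
    · rw [if_pos hy, if_pos hy]
      rcases hx.eq_or_lt with rfl | hx
      · rw [if_neg (lt_irrefl _), atZero_eq h0]
        simp only [ENNReal.ofReal_zero, zero_mul, zero_add, EReal.coe_ennreal_zero]
        rw [← EReal.coe_mul, ← EReal.coe_neg]
        congr 1
        ring
      · have ht := div_pos hx hy
        rw [if_pos hx, hf _ ht, ← ENNReal.ofReal_mul hx.le, EReal.coe_ennreal_ofReal,
          max_eq_left (mul_nonneg hx.le (hK _ ht)), ← EReal.coe_add, ← EReal.coe_neg]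
        congr 1
        field_simp
        ring
  have h1 := extIntegral_eq_lintegral_add (μ := P + Q)
    (X := fun a => -perspective f (dens₁ P Q a) (dens₂ P Q a))
    (measurable_weight hKm 0 (isDensity₁ P Q).measurable (isDensity₂ P Q).measurable)
    (measurable_dens_add P Q 0 (-d)) (integrable_dens_add P Q 0 (-d))
    (Eventually.of_forall fun a => key _ _ ((isDensity₁ P Q).nonneg a)
      ((isDensity₂ P Q).nonneg a))
  rw [integral_dens_add, zero_add] at h1
  -- The integrand is at most d q, so its positive part has integral at most d.
  have h2 : ∫⁻ a, (- -perspective f (dens₁ P Q a) (dens₂ P Q a)).toENNReal ∂(P + Q) ≠ ∞ := by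
    refine ne_top_of_le_ne_top (b := ENNReal.ofReal d) ENNReal.ofReal_ne_top ?_
    have : ∫⁻ a, ENNReal.ofReal d * ENNReal.ofReal (dens₂ P Q a) ∂(P + Q) = ENNReal.ofReal d := by
      rw [lintegral_const_mul' _ _ ENNReal.ofReal_ne_top, (isDensity₂ P Q).lintegral_eq_one,
        mul_one]
    rw [← this]
    refine lintegral_mono fun a => ?_
    rw [← ENNReal.ofReal_mul hd, ← EReal.real_coe_toENNReal]
    refine EReal.toENNReal_le_toENNReal ?_
    rw [EReal.neg_le, key _ _ ((isDensity₁ P Q).nonneg a) ((isDensity₂ P Q).nonneg a)]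
    refine le_trans (le_of_eq ?_) (le_add_of_nonneg_left (EReal.coe_ennreal_nonneg _))
    rw [← EReal.coe_neg]
    congr 1
    ring
  have h3 := extIntegral_neg_of_ne_top h2
  simp only [neg_neg] at h3
  rw [h1, EReal.neg_add (Or.inl (EReal.coe_ennreal_ne_bot _)) (Or.inr (EReal.coe_ne_bot _)),
    EReal.coe_neg] at h3
  change extIntegral (P + Q) (fun a => perspective f (dens₁ P Q a) (dens₂ P Q a)) = _
  rw [h3, sub_eq_add_neg, neg_neg, add_comm, sub_eq_add_neg]

/-- `f`-divergences from the upper tail of the spectrum. -/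
theorem fDiv_eq_intOn_tail {b : ℝ} (hb : 1 < b) {k : ℝ} (hk : 0 ≤ k) {f g G : ℝ → ℝ} {c d : ℝ}
    {L : ℝ≥0∞} (hgm : Measurable g) (hGm : Measurable G) (hG : ContinuousOn G (Ici k))
    (hG' : ∀ x ∈ Ioi k, HasDerivAt G (g x) x) (hg : ∀ x ∈ Ioi k, 0 ≤ g x) (hGk : G k = 0)
    (hL : Tendsto (fun x => ENNReal.ofReal (G x)) atTop (𝓝 L))
    (hf : ∀ t, 0 < t → f t = t * G (max k t) + c * t + d) :
    fDiv f P Q = intOn (Ioi k) (fun β => g β * (1 - spectrumRI b P Q (Real.logb b β))) +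
      ((c + d : ℝ) : EReal) := by
  have hmono : MonotoneOn G (Ici k) := by
    refine monotoneOn_of_deriv_nonneg (convex_Ici k) hG ?_ ?_ <;> rw [interior_Ici]
    · exact fun x hx => (hG' x hx).differentiableAt.differentiableWithinAt
    · exact fun x hx => (hG' x hx).deriv ▸ hg x hx
  rw [intOn_tail P Q hb hk hgm hG hG' hg hGk hL]
  have hcont : Continuous fun t => G (max k t) :=
    hG.comp_continuous (continuous_const.max continuous_id) fun t => le_max_left k t
  refine fDiv_eq_lintegral_weight_add P Q (measurable_comp_max hGm k) (fun t _ => ?_) hf ?_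
    (Or.inl ?_)
  · exact hGk ▸ hmono self_mem_Ici (le_max_left k t) (le_max_left k t)
  · refine hL.congr' ?_
    filter_upwards [eventually_ge_atTop k] with t ht
    rw [max_eq_right ht]
  -- K is continuous at 0, so f(0) = d automatically and no absolute continuity is needed.
  · have h : Tendsto (fun t => t * G (max k t) + c * t + d) (𝓝 0) (𝓝 d) := by
      have : Continuous fun t => t * G (max k t) + c * t + d :=
        ((continuous_id.mul hcont).add (continuous_const.mul continuous_id)).add continuous_const
      simpa using this.tendsto 0
    exact (h.mono_left nhdsWithin_le_nhds).congr' (eventually_nhdsWithin_of_forall fun t ht =>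
      (hf t ht).symm)

lemma antitoneOn_head {k : ℝ} {g G : ℝ → ℝ} (hG' : ∀ x ∈ Ioc 0 k, HasDerivAt G (-g x) x)
    (hg : ∀ x ∈ Ioo 0 k, 0 ≤ g x) : AntitoneOn G (Ioc 0 k) := by
  refine antitoneOn_of_deriv_nonpos (convex_Ioc 0 k)
    (fun x hx => (hG' x hx).continuousAt.continuousWithinAt) ?_ ?_ <;> rw [interior_Ioc]
  · exact fun x hx => (hG' x ⟨hx.1, hx.2.le⟩).differentiableAt.differentiableWithinAt
  · exact fun x hx => (hG' x ⟨hx.1, hx.2.le⟩).deriv ▸ by linarith [hg x hx]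

lemma head_nonneg {k : ℝ} (hk : 0 < k) {g G : ℝ → ℝ}
    (hG' : ∀ x ∈ Ioc 0 k, HasDerivAt G (-g x) x)
    (hg : ∀ x ∈ Ioo 0 k, 0 ≤ g x) (hGk : G k = 0) {t : ℝ} (ht : 0 < t) : 0 ≤ G (min k t) :=
  hGk ▸ antitoneOn_head hG' hg ⟨lt_min hk ht, min_le_left k t⟩ ⟨hk, le_rfl⟩ (min_le_left k t)

/-- `f`-divergences from the spectrum on a bounded interval, for `Q ≪ P`. -/
theorem fDiv_eq_intOn_head {b : ℝ} (hb : 1 < b) (hQP : Q ≪ P) {k : ℝ} (hk : 0 < k)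
    {f g G : ℝ → ℝ} {c d : ℝ} (hgm : Measurable g) (hGm : Measurable G)
    (hG' : ∀ x ∈ Ioc 0 k, HasDerivAt G (-g x) x) (hg : ∀ x ∈ Ioo 0 k, 0 ≤ g x) (hGk : G k = 0)
    (hf : ∀ t, 0 < t → f t = t * G (min k t) + c * t + d) :
    fDiv f P Q = intOn (Ioo 0 k) (fun β => g β * spectrumRI b P Q (Real.logb b β)) +
      ((c + d : ℝ) : EReal) := by
  rw [intOn_head P Q hb hgm hG' hg hGk]
  refine fDiv_eq_lintegral_weight_add P Q (measurable_comp_min hGm k)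
    (fun t ht => head_nonneg hk hG' hg hGk ht) hf ?_ (Or.inr hQP)
  refine tendsto_const_nhds.congr' ?_
  filter_upwards [eventually_ge_atTop k] with t ht
  rw [min_eq_left ht, hGk, ENNReal.ofReal_zero]

end Perspective

lemma hasDerivAt_const_div {C x : ℝ} (hx : x ≠ 0) :
    HasDerivAt (fun β : ℝ => C / β) (-(C * (x ^ 2)⁻¹)) x := by
  have := (hasDerivAt_inv hx).const_mul C
  rw [mul_neg] at this
  simpa [div_eq_mul_inv] using this

/-- Used to split a kernel at 1; the part living on (0, 1) contributes nothing at ∞. -/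
lemma weight_add {K₁ K₂ : ℝ → ℝ} (h₁ : ∀ t, 0 < t → 0 ≤ K₁ t) (h₂ : ∀ t, 0 < t → 0 ≤ K₂ t)
    (L : ℝ≥0∞) {x y : ℝ} (hx : 0 ≤ x) :
    weight (fun t => K₁ t + K₂ t) L x y = weight K₁ L x y + weight K₂ 0 x y := by
  unfold weight
  rcases hx.eq_or_lt with rfl | hx
  · simp
  · rw [← mul_add]
    split_ifs with hy
    · rw [ENNReal.ofReal_add (h₁ _ (div_pos hx hy)) (h₂ _ (div_pos hx hy))]
    · simp

/-! ### Hellinger, chi-type, total variation, DeGroot, triangular and E_γ -/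

section Divergences

variable {A : Type*} [MeasurableSpace A] (P Q : Measure A) [IsProbabilityMeasure P]
  [IsProbabilityMeasure Q]

/-- Here f(t) = 1/(1-α) - t K(t) with K(t) = t^(α-1)/(1-α), which decreases to 0 at ∞. K blows up at
0, but t K(t) → 0 there. -/
theorem hellinger_eq_of_lt_one {b : ℝ} (hb : 1 < b) {α : ℝ} (h0 : 0 < α) (h1 : α < 1) :
    hellinger α P Q = ((1 / (1 - α) : ℝ) : EReal) -
      intOn (Ioi 0) (fun β => β ^ (α - 2) * spectrumRI b P Q (Real.logb b β)) := by
  have hα : 0 < 1 - α := by linarith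
  have hα' : α - 1 ≠ 0 := by linarith
  rw [intOn_halfLine P Q hb (G := fun β => β ^ (α - 1) / (1 - α)) (by fun_prop) ?_ ?_ ?_]
  · refine fDiv_eq_sub_lintegral_weight P Q (by fun_prop) (by positivity) ?_ ?_ ?_ ?_
    · intro t ht
      positivity
    · intro t ht
      have : t ^ α = t * t ^ (α - 1) := by
        rw [Real.rpow_sub_one ht.ne']
        field_simp
      rw [this]
      field_simp
      ring
    · have := (tendsto_rpow_neg_atTop hα).div_const (1 - α)
      simpa using this
    · have h2 : Tendsto (fun t : ℝ => (t ^ α - 1) / (α - 1)) (𝓝 0) (𝓝 ((0 ^ α - 1) / (α - 1))) :=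
        (((Real.continuousAt_rpow_const 0 α (Or.inr h0.le)).tendsto).sub_const 1).div_const _
      have e : ((0 : ℝ) ^ α - 1) / (α - 1) = 1 / (1 - α) := by
        rw [Real.zero_rpow h0.ne']
        field_simp
        ring
      rw [e] at h2
      exact h2.mono_left nhdsWithin_le_nhds
  · intro x hx
    have := (Real.hasDerivAt_rpow_const (x := x) (p := α - 1) (Or.inl (ne_of_gt hx))).div_const
      (1 - α)
    refine this.congr_deriv ?_
    rw [show α - 1 - 1 = α - 2 by ring]
    field_simp
    ring
  · exact fun x hx => Real.rpow_nonneg (le_of_lt hx) _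
  · have := (tendsto_rpow_neg_atTop hα).div_const (1 - α)
    simpa using this

theorem hellinger_eq_of_one_lt {b : ℝ} (hb : 1 < b) {α : ℝ} (h1 : 1 < α) :
    hellinger α P Q =
      intOn (Ioi 0) (fun β => β ^ (α - 2) * (1 - spectrumRI b P Q (Real.logb b β))) -
        ((1 / (α - 1) : ℝ) : EReal) := by
  have hα : 0 < α - 1 := by linarith
  have := fDiv_eq_intOn_tail P Q hb le_rfl (f := fun t => (t ^ α - 1) / (α - 1))
    (g := fun β => β ^ (α - 2)) (G := fun β => β ^ (α - 1) / (α - 1)) (c := 0)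
    (d := -(1 / (α - 1))) (L := ∞) (by fun_prop) (by fun_prop) ?_ ?_ ?_ ?_ ?_ ?_
  · rw [zero_add, EReal.coe_neg, ← sub_eq_add_neg] at this
    exact this
  · exact (Real.continuous_rpow_const hα.le).div_const _ |>.continuousOn
  · intro x hx
    have := (Real.hasDerivAt_rpow_const (x := x) (p := α - 1) (Or.inl (ne_of_gt hx))).div_const
      (α - 1)
    refine this.congr_deriv ?_
    rw [show α - 1 - 1 = α - 2 by ring]
    field_simp
  · exact fun x hx => Real.rpow_nonneg (le_of_lt hx) _
  · simp [Real.zero_rpow hα.ne']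
  · exact ENNReal.tendsto_ofReal_nhds_top.2 ((tendsto_rpow_atTop hα).atTop_div_const hα)
  · intro t ht
    have : t ^ α = t * t ^ (α - 1) := by
      rw [Real.rpow_sub_one ht.ne']
      field_simp
    simp only [this, max_eq_right ht.le]
    field_simp
    ring

theorem chiSq_eq {b : ℝ} (hb : 1 < b) :
    chiSq P Q = intOn (Ioi 0) (fun β => 1 - spectrumRI b P Q (Real.logb b β)) - 1 := by
  have := fDiv_eq_intOn_tail P Q hb le_rfl (f := fun t => (t - 1) ^ 2) (g := fun _ => 1)
    (G := fun β => β) (c := -2) (d := 1) (L := ∞) (by fun_prop) (by fun_prop)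
    continuousOn_id (fun x _ => hasDerivAt_id x) (fun _ _ => zero_le_one) rfl
    (ENNReal.tendsto_ofReal_nhds_top.2 tendsto_id)
    (fun t ht => by rw [max_eq_right ht.le]; ring)
  simp only [one_mul] at this
  rw [chiSq, this, show (-2 + 1 : ℝ) = -1 by norm_num, EReal.coe_neg, ← sub_eq_add_neg,
    EReal.coe_one]

theorem triangular_eq {b : ℝ} (hb : 1 < b) : triangular P Q =
    4 * intOn (Ioi 0) (fun β => (1 - spectrumRI b P Q (Real.logb b β)) / (β + 1) ^ 2) - 2 := by
  have := fDiv_eq_intOn_tail P Q hb le_rfl (f := fun t => (t - 1) ^ 2 / (t + 1))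
    (g := fun β => 4 * ((β + 1) ^ 2)⁻¹)
    -- The decomposition is (t-1)²/(t+1) = t (4 - 4/(t+1)) - 3t + 1.
    (G := fun β => 4 - 4 / (β + 1)) (c := -3) (d := 1) (L := ENNReal.ofReal 4) (by fun_prop)
    (by fun_prop) ?_ ?_ ?_ ?_ ?_ ?_
  · rw [triangular, this, show (-3 + 1 : ℝ) = -2 by norm_num, EReal.coe_neg, ← sub_eq_add_neg,
      show (4 : EReal) = ((4 : ℝ) : EReal) from rfl, ← intOn_const_mul (by norm_num)]
    congr 2
    ext β
    ring
  · refine ContinuousOn.sub continuousOn_const (ContinuousOn.div continuousOn_const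
      (by fun_prop) fun x hx => ?_)
    have : (0 : ℝ) ≤ x := hx
    positivity
  · intro x hx
    have hx' : x + 1 ≠ 0 := by have : (0 : ℝ) < x := hx; positivity
    rw [← neg_neg (4 * ((x + 1) ^ 2)⁻¹)]
    exact ((hasDerivAt_const_div (C := 4) hx').comp_add_const x 1).const_sub 4
  · intro x hx
    positivity
  · norm_num
  · refine ENNReal.tendsto_ofReal ?_
    have h : Tendsto (fun x : ℝ => 4 / (x + 1)) atTop (𝓝 0) :=
      (tendsto_atTop_add_const_right _ 1 tendsto_id).const_div_atTop 4
    simpa using h.const_sub 4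
  · intro t ht
    simp only [max_eq_right ht.le]
    field_simp
    ring

/-- The term t (C/k - C/max(k,t)) equals the hinge (C/k)(t-k)⁺, so this serves piecewise linear f
with one kink at k. -/
lemma fDiv_eq_intOn_tail_inv_sq {b : ℝ} (hb : 1 < b) {C k : ℝ} (hC : 0 < C) (hk : 0 < k)
    {f : ℝ → ℝ} {c d : ℝ}
    (hf : ∀ t, 0 < t → f t = t * (C / k - C / max k t) + c * t + d) :
    fDiv f P Q = (C : EReal) *
      intOn (Ioi k) (fun β => (1 - spectrumRI b P Q (Real.logb b β)) / β ^ 2) +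
        ((c + d : ℝ) : EReal) := by
  rw [fDiv_eq_intOn_tail P Q hb hk.le (g := fun β => C * (β ^ 2)⁻¹)
    (G := fun β => C / k - C / β) (L := ENNReal.ofReal (C / k)) (by fun_prop) (by fun_prop)
    ?_ ?_ ?_ (sub_self _) ?_ hf, ← intOn_const_mul hC]
  · congr 2
    ext β
    ring
  · exact ContinuousOn.sub continuousOn_const (ContinuousOn.div continuousOn_const
      continuousOn_id fun x hx => (hk.trans_le hx).ne')
  · intro x hx
    have hx' : x ≠ 0 := (hk.trans hx).ne'
    rw [← neg_neg (C * (x ^ 2)⁻¹)]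
    exact (hasDerivAt_const_div hx').const_sub _
  · intro x hx
    positivity
  · refine ENNReal.tendsto_ofReal ?_
    simpa using (tendsto_id.const_div_atTop C).const_sub (C / k)

/-- The reflected hinge (C/k)(k-t)⁺ tends to C, not 0, as t ↓ 0; this is where `Q ≪ P` enters. -/
lemma fDiv_eq_intOn_head_inv_sq {b : ℝ} (hb : 1 < b) (hQP : Q ≪ P) {C k : ℝ} (hC : 0 < C)
    (hk : 0 < k) {f : ℝ → ℝ} {c d : ℝ}
    (hf : ∀ t, 0 < t → f t = t * (C / min k t - C / k) + c * t + d) :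
    fDiv f P Q = (C : EReal) *
      intOn (Ioo 0 k) (fun β => spectrumRI b P Q (Real.logb b β) / β ^ 2) +
        ((c + d : ℝ) : EReal) := by
  rw [fDiv_eq_intOn_head P Q hb hQP hk (g := fun β => C * (β ^ 2)⁻¹)
    (G := fun β => C / β - C / k) (by fun_prop) (by fun_prop)
    ?_ ?_ (sub_self _) hf, ← intOn_const_mul hC]
  · congr 2
    ext β
    ring
  · exact fun x hx => (hasDerivAt_const_div hx.1.ne').sub_const _
  · intro x hx
    positivity

theorem tvDist_eq_tail {b : ℝ} (hb : 1 < b) : tvDist P Q =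
    2 * intOn (Ioi 1) (fun β => (1 - spectrumRI b P Q (Real.logb b β)) / β ^ 2) := by
  rw [tvDist, fDiv_eq_intOn_tail_inv_sq P Q hb (C := 2) (k := 1) (c := -1) (d := 1)
    (by norm_num) (by norm_num)]
  · norm_num
    rfl
  · intro t ht
    rcases le_total 1 t with h | h
    · rw [max_eq_right h, abs_of_nonneg (by linarith)]
      field_simp
      ring
    · rw [max_eq_left h, abs_of_nonpos (by linarith)]
      ring

theorem tvDist_eq_head {b : ℝ} (hb : 1 < b) (hQP : Q ≪ P) : tvDist P Q =
    2 * intOn (Ioo 0 1) (fun β => spectrumRI b P Q (Real.logb b β) / β ^ 2) := by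
  rw [tvDist, fDiv_eq_intOn_head_inv_sq P Q hb hQP (C := 2) (k := 1) (c := 1) (d := -1)
    (by norm_num) (by norm_num)]
  · norm_num
    rfl
  · intro t ht
    rcases le_total 1 t with h | h
    · rw [min_eq_left h, abs_of_nonneg (by linarith)]
      ring
    · rw [min_eq_right h, abs_of_nonpos (by linarith)]
      field_simp
      ring

theorem deGroot_eq_head {b : ℝ} (hb : 1 < b) (hQP : Q ≪ P) {w : ℝ} (hw : 1 / 2 < w)
    (hw1 : w < 1) : deGroot w P Q = ((1 - w : ℝ) : EReal) *
      intOn (Ioo 0 ((1 - w) / w)) (fun β => spectrumRI b P Q (Real.logb b β) / β ^ 2) := by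
  have hw0 : 0 < w := by linarith
  have hw' : 0 < 1 - w := by linarith
  -- For w > 1/2 the function is exactly the hinge w (k-t)⁺ with k = (1-w)/w, so C = wk = 1 - w.
  rw [deGroot, fDiv_eq_intOn_head_inv_sq P Q hb hQP (C := 1 - w) (k := (1 - w) / w) (c := 0)
    (d := 0) hw' (by positivity)]
  · simp
  · intro t ht
    rw [min_eq_right (by linarith : 1 - w ≤ w)]
    rcases le_total ((1 - w) / w) t with h | h
    · rw [min_eq_left h]
      rw [div_le_iff₀ hw0] at h
      rw [min_eq_right (by linarith)]
      ring
    · rw [min_eq_right h]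
      rw [le_div_iff₀ hw0] at h
      rw [min_eq_left (by linarith)]
      field_simp
      ring

theorem deGroot_eq_tail {b : ℝ} (hb : 1 < b) {w : ℝ} (hw0 : 0 < w) (hw : w ≤ 1 / 2) :
    deGroot w P Q = ((1 - w : ℝ) : EReal) *
      intOn (Ioi ((1 - w) / w)) (fun β => (1 - spectrumRI b P Q (Real.logb b β)) / β ^ 2) := by
  have hw' : 0 < 1 - w := by linarith
  rw [deGroot, fDiv_eq_intOn_tail_inv_sq P Q hb (C := 1 - w) (k := (1 - w) / w) (c := -w)
    (d := w) hw' (by positivity)]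
  · simp
  · intro t ht
    rw [min_eq_left (by linarith : w ≤ 1 - w)]
    rcases le_total ((1 - w) / w) t with h | h
    · rw [max_eq_right h]
      rw [div_le_iff₀ hw0] at h
      rw [min_eq_right (by linarith)]
      field_simp
      ring
    · rw [max_eq_left h]
      rw [le_div_iff₀ hw0] at h
      rw [min_eq_left (by linarith)]
      ring

/-- |t-1|^s = t (K₁ + K₂), with K₁ = (t-1)^s/t on [1, ∞) increasing, K₂ = (1-t)^s/t on (0, 1]
decreasing, each 0 elsewhere. As t K₂ → 1 at the origin, `Q ≪ P` is needed. -/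
theorem chiPow_eq {b : ℝ} (hb : 1 < b) (hQP : Q ≪ P) {s : ℝ} (hs : 1 ≤ s) :
    chiPow s P Q =
      intOn (Ioi 1) (fun β => 1 / β * (s - 1 + 1 / β) * (β - 1) ^ (s - 1) *
        (1 - spectrumRI b P Q (Real.logb b β))) +
      intOn (Ioo 0 1) (fun β => 1 / β * (s - 1 + 1 / β) * (1 - β) ^ (s - 1) *
        spectrumRI b P Q (Real.logb b β)) := by
  have hs0 : 0 < s := by linarith
  have hs1 : 0 ≤ s - 1 := by linarith
  obtain ⟨L, hL⟩ : ∃ L : ℝ≥0∞,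
      Tendsto (fun t : ℝ => ENNReal.ofReal ((t - 1) ^ s / t)) atTop (𝓝 L) := by
    have h1 : Tendsto (fun t : ℝ => (t - 1) / t) atTop (𝓝 1) := by
      have := (tendsto_id.const_div_atTop (1 : ℝ)).const_sub 1
      rw [sub_zero] at this
      refine this.congr' ?_
      filter_upwards [eventually_gt_atTop 0] with t ht
      simp only [id]
      field_simp
    -- The limit of K₁ at ∞ is 1 for s = 1 and ∞ for s > 1.
    rcases hs.eq_or_lt with rfl | hs
    · exact ⟨_, ENNReal.tendsto_ofReal (by simpa using h1)⟩
    · refine ⟨∞, ENNReal.tendsto_ofReal_nhds_top.2 ?_⟩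
      have h2 : Tendsto (fun t : ℝ => (t - 1) ^ (s - 1)) atTop atTop :=
        (tendsto_rpow_atTop (by linarith)).comp (tendsto_atTop_add_const_right _ (-1) tendsto_id)
      refine (h1.pos_mul_atTop zero_lt_one h2).congr' ?_
      filter_upwards [eventually_gt_atTop 1] with t ht
      rw [Real.rpow_sub_one (by linarith)]
      have : t - 1 ≠ 0 := by linarith
      field_simp
  have hd1 : ∀ x ∈ Ioi (1 : ℝ), HasDerivAt (fun β : ℝ => (β - 1) ^ s / β)
      (1 / x * (s - 1 + 1 / x) * (x - 1) ^ (s - 1)) x := by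
    intro x hx
    have hx1 : x - 1 ≠ 0 := by have : 1 < x := hx; linarith
    have hx0 : x ≠ 0 := by have : 1 < x := hx; linarith
    have := (((hasDerivAt_id x).sub_const 1).rpow_const (p := s) (Or.inr hs)).div
      (hasDerivAt_id x) hx0
    refine this.congr_deriv ?_
    simp only [id]
    rw [Real.rpow_sub_one hx1]
    field_simp
    ring
  have hd2 : ∀ x ∈ Ioc (0 : ℝ) 1, HasDerivAt (fun β : ℝ => (1 - β) ^ s / β)
      (-(1 / x * (s - 1 + 1 / x) * (1 - x) ^ (s - 1))) x := by
    intro x hx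
    have hx0 : x ≠ 0 := hx.1.ne'
    have := (((hasDerivAt_id x).const_sub 1).rpow_const (p := s) (Or.inr hs)).div
      (hasDerivAt_id x) hx0
    refine this.congr_deriv ?_
    simp only [id]
    -- At x = 1 the power on the right may be 0^0 = 1, but the factor 1 - x vanishes.
    have e : (1 - x) ^ s = (1 - x) * (1 - x) ^ (s - 1) := by
      rcases hx.2.eq_or_lt with rfl | hx1
      · simp [Real.zero_rpow hs0.ne']
      · rw [Real.rpow_sub_one (by linarith)]
        have : 1 - x ≠ 0 := by linarith
        field_simp
    rw [e]
    field_simp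
    ring
  have hc : ContinuousOn (fun β : ℝ => (β - 1) ^ s / β) (Ici 1) :=
    ContinuousOn.div (((continuous_id.sub continuous_const).rpow_const
      fun _ => Or.inr hs0.le).continuousOn) continuousOn_id fun x hx =>
        (zero_lt_one.trans_le hx).ne'
  have hg1 : ∀ x ∈ Ioi (1 : ℝ), 0 ≤ 1 / x * (s - 1 + 1 / x) * (x - 1) ^ (s - 1) := by
    intro x hx
    have hx1 : 0 ≤ x - 1 := by have : 1 < x := hx; linarith
    have hx0 : 0 < x := by have : 1 < x := hx; linarith
    positivity
  have hg2 : ∀ x ∈ Ioo (0 : ℝ) 1, 0 ≤ 1 / x * (s - 1 + 1 / x) * (1 - x) ^ (s - 1) := by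
    intro x hx
    have hx1 : 0 ≤ 1 - x := by linarith [hx.2]
    have hx0 : 0 < x := hx.1
    positivity
  have hz1 : ((1 : ℝ) - 1) ^ s / 1 = 0 := by simp [Real.zero_rpow hs0.ne']
  have hK1 (t : ℝ) (ht : 0 < t) : 0 ≤ (max 1 t - 1) ^ s / max 1 t :=
    div_nonneg (Real.rpow_nonneg (by linarith [le_max_left 1 t]) _) (by positivity)
  have hK2 (t : ℝ) (ht : 0 < t) : 0 ≤ (1 - min 1 t) ^ s / min 1 t :=
    div_nonneg (Real.rpow_nonneg (by linarith [min_le_left 1 t]) _) (by positivity)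
  rw [intOn_tail P Q hb zero_le_one (G := fun β => (β - 1) ^ s / β) (by fun_prop) hc hd1 hg1
    hz1 hL, intOn_head P Q hb (G := fun β => (1 - β) ^ s / β) (by fun_prop) hd2 hg2 hz1,
    ← EReal.coe_ennreal_add, ← lintegral_add_left (measurable_weight
      (measurable_comp_max (G := fun β => (β - 1) ^ s / β) (by fun_prop) 1) L
        (isDensity₁ P Q).measurable (isDensity₂ P Q).measurable)]
  have := fDiv_eq_lintegral_weight_add P Q (f := fun t => |t - 1| ^ s)
    (K := fun t => (max 1 t - 1) ^ s / max 1 t + (1 - min 1 t) ^ s / min 1 t) (c := 0) (d := 0)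
    (L := L) (by fun_prop) (fun t ht => add_nonneg (hK1 t ht) (hK2 t ht)) ?_ ?_ (Or.inr hQP)
  · rw [chiPow, this, add_zero, EReal.coe_zero, add_zero]
    congr 2
    ext a
    exact weight_add hK1 hK2 L ((isDensity₁ P Q).nonneg a)
  · intro t ht
    rcases le_total 1 t with h | h
    · rw [max_eq_right h, min_eq_left h, abs_of_nonneg (by linarith), hz1]
      field_simp
      ring
    · rw [max_eq_left h, min_eq_right h, abs_of_nonpos (by linarith), hz1, neg_sub]
      field_simp
      ring
  · refine hL.congr' ?_
    filter_upwards [eventually_ge_atTop 1] with t ht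
    rw [max_eq_right ht, min_eq_left ht, hz1, add_zero]

/-- P(U) - γQ(U) is the integral of p - γq over U, largest for U = {p ≥ γq}. -/
lemma eGamma_eq_lintegral (γ : ℝ) : ((eGamma γ P Q : ℝ) : EReal) =
    ((∫⁻ a, ENNReal.ofReal (dens₁ P Q a - γ * dens₂ P Q a) ∂(P + Q) : ℝ≥0∞) : EReal) := by
  have hp := isDensity₁ P Q
  have hq := isDensity₂ P Q
  set d : A → ℝ := fun a => dens₁ P Q a - γ * dens₂ P Q a with hd
  have hdi : Integrable d (P + Q) := hp.integrable.sub (hq.integrable.const_mul γ)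
  have hdm : Measurable d := hp.measurable.sub (hq.measurable.const_mul γ)
  have hreal (R : Measure A) [IsProbabilityMeasure R] {r : A → ℝ} (hr : IsDensity R (P + Q) r)
      {U : Set A} (hU : MeasurableSet U) : R.real U = ∫ a in U, r a ∂(P + Q) := by
    rw [integral_eq_lintegral_of_nonneg_ae (Eventually.of_forall hr.nonneg)
      hr.measurable.aestronglyMeasurable, ← hr.apply hU]
    rfl
  have hU {U : Set A} (hU : MeasurableSet U) :
      P.real U - γ * Q.real U = ∫ a in U, d a ∂(P + Q) := by
    rw [hreal P hp hU, hreal Q hq hU, ← integral_const_mul,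
      ← integral_sub hp.integrable.integrableOn (hq.integrable.const_mul γ).integrableOn]
  have hm : MeasurableSet {a | 0 ≤ d a} := measurableSet_le measurable_const hdm
  have hmax : ∫⁻ a, ENNReal.ofReal (d a) ∂(P + Q) =
      ENNReal.ofReal (∫ a in {a | 0 ≤ d a}, d a ∂(P + Q)) := by
    have hn : ∀ᵐ a ∂(P + Q).restrict {a | 0 ≤ d a}, 0 ≤ d a := ae_restrict_mem hm
    rw [ofReal_integral_eq_lintegral_ofReal hdi.integrableOn hn,
      ← lintegral_indicator hm]
    refine lintegral_congr fun a => ?_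
    by_cases ha : 0 ≤ d a
    · simp [ha]
    · simp [ha, ENNReal.ofReal_of_nonpos (not_le.1 ha).le]
  have hnn : 0 ≤ ∫ a in {a | 0 ≤ d a}, d a ∂(P + Q) := setIntegral_nonneg hm fun a ha => ha
  have hg : IsGreatest {x : ℝ | ∃ U : Set A, MeasurableSet U ∧ x = P.real U - γ * Q.real U}
      (∫ a in {a | 0 ≤ d a}, d a ∂(P + Q)) := by
    refine ⟨⟨_, hm, (hU hm).symm⟩, ?_⟩
    rintro x ⟨U, hUm, rfl⟩
    rw [hU hUm]
    exact setIntegral_le_nonneg hUm hdm.stronglyMeasurable hdi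
  rw [eGamma, hg.csSup_eq, hmax, EReal.coe_ennreal_ofReal, max_eq_left hnn]

theorem eGamma_eq {b : ℝ} (hb : 1 < b) {γ : ℝ} (hγ : 1 ≤ γ) : ((eGamma γ P Q : ℝ) : EReal) =
    (γ : EReal) *
      intOn (Ioi γ) (fun β => (1 - spectrumRI b P Q (Real.logb b β)) / β ^ 2) := by
  have hγ0 : 0 < γ := by linarith
  rw [eGamma_eq_lintegral P Q, ← intOn_const_mul hγ0]
  -- With this primitive p K(p/q) = (p - γq)⁺, and its limit 1 at ∞ gives p where q = 0.
  have := intOn_tail P Q hb hγ0.le (g := fun β => γ * (β ^ 2)⁻¹) (G := fun β => 1 - γ / β)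
    (L := ENNReal.ofReal 1) (by fun_prop) ?_ ?_ ?_ ?_ ?_
  · rw [intOn_congr measurableSet_Ioi
      (g' := fun β => γ * (β ^ 2)⁻¹ * (1 - spectrumRI b P Q (Real.logb b β)))
      (fun β _ => by ring), this]
    congr 1
    refine lintegral_congr fun a => ?_
    unfold weight
    have hp := (isDensity₁ P Q).nonneg a
    rcases ((isDensity₂ P Q).nonneg a).eq_or_lt with hq | hq
    · rw [← hq, if_neg (lt_irrefl _), ENNReal.ofReal_one, mul_zero, sub_zero, mul_one]
    · rw [if_pos hq, ← ENNReal.ofReal_mul hp]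
      beta_reduce
      rcases le_total γ (dens₁ P Q a / dens₂ P Q a) with h | h
      · have hp' : 0 < dens₁ P Q a := by
          have := (div_pos_iff_of_pos_right hq).1 (hγ0.trans_le h)
          exact this
        rw [max_eq_right h]
        congr 1
        field_simp
      · rw [max_eq_left h, div_self hγ0.ne', sub_self, mul_zero, ENNReal.ofReal_zero]
        rw [div_le_iff₀ hq] at h
        exact ENNReal.ofReal_of_nonpos (by linarith)
  · exact ContinuousOn.sub continuousOn_const (ContinuousOn.div continuousOn_const
      continuousOn_id fun x hx => (hγ0.trans_le hx).ne')
  · intro x hx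
    have hx' : x ≠ 0 := (hγ0.trans hx).ne'
    rw [← neg_neg (γ * (x ^ 2)⁻¹)]
    exact (hasDerivAt_const_div hx').const_sub _
  · intro x hx
    positivity
  · rw [div_self hγ0.ne', sub_self]
  · refine ENNReal.tendsto_ofReal ?_
    simpa using (tendsto_id.const_div_atTop γ).const_sub 1

end Divergences

/-! ### Relative entropy -/

section KullbackLeibler

open InformationTheory

/-- The integrand `y φ(x/y)` with `φ(t) = t log t + 1 - t`, for `x, y ≥ 0`. -/
noncomputable def klKernel (x y : ℝ) : ℝ≥0∞ :=
  if 0 < y then ENNReal.ofReal (y * klFun (x / y)) else if 0 < x then ∞ else 0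

variable {A : Type*} [MeasurableSpace A]

lemma measurable_klKernel {p q : A → ℝ} (hp : Measurable p) (hq : Measurable q) :
    Measurable fun a => klKernel (p a) (q a) := by
  unfold klKernel
  exact Measurable.ite (measurableSet_lt measurable_const hq)
    (hq.mul (measurable_klFun.comp (hp.div hq))).ennreal_ofReal
    (Measurable.ite (measurableSet_lt measurable_const hp) measurable_const measurable_const)

/-- If {q = 0 < p} is `μ`-null then P ≪ Q with dP/dQ = p/q. Otherwise the kernel is infinite on a
non-null set, matching the value ∞ of `klDiv` without absolute continuity. -/
lemma klDiv_eq_lintegral_klKernel {P Q μ : Measure A} [IsFiniteMeasure P] [IsFiniteMeasure Q]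
    {p q : A → ℝ} (hp : IsDensity P μ p) (hq : IsDensity Q μ q) :
    klDiv P Q = ∫⁻ a, klKernel (p a) (q a) ∂μ := by
  by_cases h : ∀ᵐ a ∂μ, q a = 0 → p a = 0
  · have hr : Measurable fun a => ENNReal.ofReal (p a / q a) :=
      (hp.measurable.div hq.measurable).ennreal_ofReal
    have hPQ : P = Q.withDensity fun a => ENNReal.ofReal (p a / q a) := by
      rw [hp.eq_withDensity, hq.eq_withDensity, ← withDensity_mul _ hq.measurable_ofReal hr]
      refine withDensity_congr_ae (h.mono fun a ha => ?_)
      simp only [Pi.mul_apply]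
      rw [← ENNReal.ofReal_mul (hq.nonneg a)]
      congr 1
      rcases eq_or_ne (q a) 0 with h0 | h0
      · rw [ha h0, zero_div, mul_zero]
      · field_simp
    have hac : P ≪ Q := hPQ ▸ withDensity_absolutelyContinuous _ _
    have hrn : P.rnDeriv Q =ᵐ[Q] fun a => ENNReal.ofReal (p a / q a) := by
      conv_lhs => rw [hPQ]
      exact Measure.rnDeriv_withDensity Q hr
    rw [klDiv_eq_lintegral_klFun_of_ac hac,
      lintegral_congr_ae (g := fun a => ENNReal.ofReal (klFun (p a / q a)))
        (hrn.mono fun a ha => by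
          simp only [ha, ENNReal.toReal_ofReal (div_nonneg (hp.nonneg a) (hq.nonneg a))]),
      hq.lintegral (f := fun a => ENNReal.ofReal (klFun (p a / q a)))
        (measurable_klFun.comp (hp.measurable.div hq.measurable)).ennreal_ofReal]
    refine lintegral_congr_ae (h.mono fun a ha => ?_)
    simp only [klKernel]
    split_ifs with h1 h2
    · exact (ENNReal.ofReal_mul h1.le).symm
    · exact absurd (ha (le_antisymm (not_lt.1 h1) (hq.nonneg a))) h2.ne'
    · rw [ENNReal.ofReal_of_nonpos (not_lt.1 h1), zero_mul]
  · rw [klDiv_of_not_ac fun hac => h (hq.ae_eq_zero_of_ac hp hac)]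
    by_contra hne
    refine h ((ae_lt_top (measurable_klKernel hp.measurable hq.measurable)
      (Ne.symm hne)).mono fun a ha h0 => ?_)
    by_contra hp0
    have : 0 < p a := lt_of_le_of_ne (hp.nonneg a) (Ne.symm hp0)
    simp [klKernel, h0, this] at ha

lemma klKernel_of_pos (x : ℝ) {y : ℝ} (hy : 0 < y) :
    klKernel x y = ENNReal.ofReal (x * Real.log (x / y) + y - x) := by
  rw [klKernel, if_pos hy, klFun_apply]
  congr 1
  field_simp

lemma klKernel_zero_left {y : ℝ} (hy : 0 ≤ y) : klKernel 0 y = ENNReal.ofReal y := by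
  rcases hy.eq_or_lt with rfl | hy
  · simp [klKernel]
  · simp [klKernel, hy, klFun_zero]

lemma mul_log_div_add_sub_nonneg {x y : ℝ} (hx : 0 < x) (hy : 0 < y) :
    0 ≤ x * Real.log (x / y) + y - x := by
  have := mul_nonneg hy.le (klFun_nonneg (div_pos hx hy).le)
  rw [klFun_apply] at this
  refine this.trans_eq ?_
  field_simp

lemma ofReal_add_ofReal_eq {a b c d : ℝ} (ha : 0 ≤ a) (hb : 0 ≤ b) (hc : 0 ≤ c) (hd : 0 ≤ d)
    (h : a + b = c + d) : ENNReal.ofReal a + ENNReal.ofReal b =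
      ENNReal.ofReal c + ENNReal.ofReal d := by
  rw [← ENNReal.ofReal_add ha hb, ← ENNReal.ofReal_add hc hd, h]

lemma weight_of_pos {K : ℝ → ℝ} {x y : ℝ} (hx : 0 < x) (hy : 0 < y) (L : ℝ≥0∞) :
    weight K L x y = ENNReal.ofReal (x * K (x / y)) := by
  rw [weight, if_pos hy, ENNReal.ofReal_mul hx.le]

lemma weight_zero_left (K : ℝ → ℝ) (L : ℝ≥0∞) (y : ℝ) : weight K L 0 y = 0 := by
  simp [weight]

lemma weight_zero_right (K : ℝ → ℝ) (L : ℝ≥0∞) (x : ℝ) :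
    weight K L x 0 = ENNReal.ofReal x * L := by
  simp [weight]

variable (P Q : Measure A) [IsProbabilityMeasure P] [IsProbabilityMeasure Q]

/-- The splitting x log(x/y) = x log⁺(x/y) - x log⁻(x/y), with the compensators x and y moved so
that only sums occur. -/
lemma weight_log_add_eq {x y : ℝ} (hx : 0 ≤ x) (hy : 0 ≤ y) :
    weight (fun t => Real.log (max 1 t)) ∞ x y + ENNReal.ofReal y =
      weight (fun t => -Real.log (min 1 t)) 0 x y + klKernel x y + ENNReal.ofReal x := by
  rcases hx.eq_or_lt with rfl | hx
  · simp [weight_zero_left, klKernel_zero_left hy]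
  rcases hy.eq_or_lt with rfl | hy
  · simp [weight_zero_right, klKernel, hx]
  have ht := div_pos hx hy
  have h1 : 0 ≤ Real.log (max 1 (x / y)) := Real.log_nonneg (le_max_left _ _)
  have h2 : 0 ≤ -Real.log (min 1 (x / y)) :=
    neg_nonneg.2 (Real.log_nonpos (by positivity) (min_le_left _ _))
  have h3 := mul_log_div_add_sub_nonneg hx hy
  rw [weight_of_pos hx hy, weight_of_pos hx hy, klKernel_of_pos x hy,
    ← ENNReal.ofReal_add (mul_nonneg hx.le h2) h3]
  refine ofReal_add_ofReal_eq (mul_nonneg hx.le h1) hy.le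
    (add_nonneg (mul_nonneg hx.le h2) h3) hx.le ?_
  rcases le_total 1 (x / y) with h | h
  · rw [max_eq_right h, min_eq_left h, Real.log_one]
    ring
  · rw [max_eq_left h, min_eq_right h, Real.log_one]
    ring

/-- From log u ≤ u - 1 at u = y/x. Integrated, it bounds the mean negative part of the relative
information by 1, so D is never of the form ∞ - ∞. -/
lemma weight_neg_log_le {x y : ℝ} (hx : 0 ≤ x) (hy : 0 ≤ y) :
    weight (fun t => -Real.log (min 1 t)) 0 x y ≤ ENNReal.ofReal y := by
  rcases hx.eq_or_lt with rfl | hx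
  · simp [weight_zero_left]
  rcases hy.eq_or_lt with rfl | hy
  · simp [weight_zero_right]
  rw [weight_of_pos hx hy]
  refine ENNReal.ofReal_le_ofReal ?_
  rcases le_total 1 (x / y) with h | h
  · rw [min_eq_left h, Real.log_one]
    simpa using hy.le
  · rw [min_eq_right h, ← Real.log_inv]
    have := Real.log_le_sub_one_of_pos (inv_pos.2 (div_pos hx hy))
    calc x * Real.log (x / y)⁻¹ ≤ x * (x / y)⁻¹ := by gcongr; linarith
      _ = y := by field_simp

lemma lintegral_weight_neg_log_le_one :
    ∫⁻ a, weight (fun t => -Real.log (min 1 t)) 0 (dens₁ P Q a) (dens₂ P Q a) ∂(P + Q) ≤ 1 := by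
  rw [← (isDensity₂ P Q).lintegral_eq_one]
  exact lintegral_mono fun a =>
    weight_neg_log_le ((isDensity₁ P Q).nonneg a) ((isDensity₂ P Q).nonneg a)

/-- The relative entropy is the difference of the expected positive and negative parts of the
relative information. -/
lemma klDiv_eq_lintegral_weight_sub : (klDiv P Q : EReal) =
    ((∫⁻ a, weight (fun t => Real.log (max 1 t)) ∞ (dens₁ P Q a) (dens₂ P Q a) ∂(P + Q) :
      ℝ≥0∞) : EReal) -
    ((∫⁻ a, weight (fun t => -Real.log (min 1 t)) 0 (dens₁ P Q a) (dens₂ P Q a) ∂(P + Q) :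
      ℝ≥0∞) : EReal) := by
  have hp := isDensity₁ P Q
  have hq := isDensity₂ P Q
  have h := lintegral_congr (μ := P + Q) fun a =>
    weight_log_add_eq (hp.nonneg a) (hq.nonneg a)
  rw [lintegral_add_right _ hq.measurable_ofReal, lintegral_add_right _ hp.measurable_ofReal,
    lintegral_add_right _ (measurable_klKernel hp.measurable hq.measurable),
    hp.lintegral_eq_one, hq.lintegral_eq_one, ← klDiv_eq_lintegral_klKernel hp hq] at h
  have := coe_sub_coe_eq_of_add_eq h (ne_top_of_le_ne_top ENNReal.one_ne_top
    (lintegral_weight_neg_log_le_one P Q)) ENNReal.one_ne_top ENNReal.one_ne_top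
  rw [this]
  simp

lemma lintegral_tail_inv {b : ℝ} (hb : 1 < b) :
    ∫⁻ β in Ioi 1, ENNReal.ofReal (β⁻¹ * (1 - spectrumRI b P Q (Real.logb b β))) =
      ∫⁻ a, weight (fun t => Real.log (max 1 t)) ∞ (dens₁ P Q a) (dens₂ P Q a) ∂(P + Q) := by
  refine lintegral_tail P Q hb zero_le_one (G := Real.log) (by fun_prop) ?_ ?_ ?_ Real.log_one ?_
  · exact fun x hx => (Real.continuousAt_log (zero_lt_one.trans_le hx).ne').continuousWithinAt
  · exact fun x hx => Real.hasDerivAt_log (zero_lt_one.trans hx).ne'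
  · exact fun x hx => inv_nonneg.2 (zero_lt_one.trans hx).le
  · exact ENNReal.tendsto_ofReal_nhds_top.2 Real.tendsto_log_atTop

lemma lintegral_head_inv {b : ℝ} (hb : 1 < b) :
    ∫⁻ β in Ioo 0 1, ENNReal.ofReal (β⁻¹ * spectrumRI b P Q (Real.logb b β)) =
      ∫⁻ a, weight (fun t => -Real.log (min 1 t)) 0 (dens₁ P Q a) (dens₂ P Q a) ∂(P + Q) := by
  refine lintegral_head P Q hb (G := fun t => -Real.log t) (by fun_prop) ?_ ?_ (by simp)
  · exact fun x hx => (Real.hasDerivAt_log hx.1.ne').neg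
  · exact fun x hx => inv_nonneg.2 hx.1.le

lemma klDiv_eq_lintegral_sub {b : ℝ} (hb : 1 < b) : (klDiv P Q : EReal) =
    ((∫⁻ β in Ioi 1, ENNReal.ofReal (β⁻¹ * (1 - spectrumRI b P Q (Real.logb b β))) :
      ℝ≥0∞) : EReal) -
    ((∫⁻ β in Ioo 0 1, ENNReal.ofReal (β⁻¹ * spectrumRI b P Q (Real.logb b β)) :
      ℝ≥0∞) : EReal) := by
  rw [lintegral_tail_inv P Q hb, lintegral_head_inv P Q hb, klDiv_eq_lintegral_weight_sub]

theorem relEntropy_eq {b : ℝ} (hb : 1 < b) :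
    ((1 / Real.logb b (Real.exp 1) : ℝ) : EReal) * relEntropy b P Q =
      intOn (Ioi 1) (fun β => (1 - spectrumRI b P Q (Real.logb b β)) / β) -
        intOn (Ioo 0 1) (fun β => spectrumRI b P Q (Real.logb b β) / β) := by
  have hlb : 0 < Real.log b := Real.log_pos hb
  have e : 1 / Real.logb b (Real.exp 1) = Real.log b := by simp [Real.logb]
  rw [e, relEntropy, EReal.mul_div_cancel (EReal.coe_ne_bot _) (EReal.coe_ne_top _)
    (by exact_mod_cast hlb.ne'), klDiv_eq_lintegral_sub P Q hb,
    ← intOn_eq_lintegral measurableSet_Ioi, ← intOn_eq_lintegral measurableSet_Ioo]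
  · simp_rw [div_eq_inv_mul]
  · exact fun β hβ => mul_nonneg (inv_nonneg.2 hβ.1.le) (spectrumRI_nonneg P Q b _)
  · exact fun β hβ => mul_nonneg (inv_nonneg.2 (zero_lt_one.trans hβ).le)
      (sub_nonneg.2 (spectrumRI_le_one P Q b _))

end KullbackLeibler

/-! ### Reversed relative entropy and Jeffreys' divergence -/

section Jeffreys

open InformationTheory

variable {A : Type*} [MeasurableSpace A] (P Q : Measure A) [IsProbabilityMeasure P]
  [IsProbabilityMeasure Q]

lemma hasDerivAt_log_add_one_div {x : ℝ} (hx : x ≠ 0) :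
    HasDerivAt (fun t => 1 - (Real.log t + 1) / t) (Real.log x / x ^ 2) x := by
  have := ((((Real.hasDerivAt_log hx).add_const 1).div (hasDerivAt_id x) hx)).const_sub 1
  refine this.congr_deriv ?_
  simp only [id]
  field_simp
  ring

lemma one_sub_log_add_one_div_nonneg {t : ℝ} (ht : 0 < t) : 0 ≤ 1 - (Real.log t + 1) / t := by
  rw [sub_nonneg, div_le_one ht]
  linarith [Real.log_le_sub_one_of_pos ht]

/-- With r = x/y, y log(y/x) + x - y = x (1 - (log r + 1)/r). The bracket vanishes at r = 1, falls
before it and rises after it to the limit 1; hence two pieces. -/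
lemma klKernel_symm_eq_weight {x y : ℝ} (hx : 0 ≤ x) (hy : 0 ≤ y) (h : x = 0 → y = 0) :
    klKernel y x = weight (fun t => 1 - (Real.log (max 1 t) + 1) / max 1 t) 1 x y +
      weight (fun t => 1 - (Real.log (min 1 t) + 1) / min 1 t) 0 x y := by
  rcases hx.eq_or_lt with rfl | hx
  · simp [h rfl, klKernel, weight_zero_left]
  rw [← weight_add (fun t ht => one_sub_log_add_one_div_nonneg (by positivity))
    (fun t ht => one_sub_log_add_one_div_nonneg (by positivity)) 1 hx.le]
  rcases hy.eq_or_lt with rfl | hy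
  · rw [klKernel_zero_left hx.le, weight_zero_right, mul_one]
  rw [klKernel_of_pos y hx, weight_of_pos hx hy, ← inv_div x y, Real.log_inv]
  congr 1
  rcases le_total 1 (x / y) with h | h
  · rw [max_eq_right h, min_eq_left h, Real.log_one]
    field_simp
    ring
  · rw [max_eq_left h, min_eq_right h, Real.log_one]
    field_simp
    ring

/-- The reversed relative entropy in terms of the spectrum. -/
lemma klDiv_symm_eq_lintegral_add {b : ℝ} (hb : 1 < b) (hQP : Q ≪ P) : klDiv Q P =
    (∫⁻ β in Ioi 1, ENNReal.ofReal
      (Real.log β / β ^ 2 * (1 - spectrumRI b P Q (Real.logb b β)))) +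
    ∫⁻ β in Ioo 0 1, ENNReal.ofReal
      (-(Real.log β / β ^ 2) * spectrumRI b P Q (Real.logb b β)) := by
  have hp := isDensity₁ P Q
  have hq := isDensity₂ P Q
  rw [klDiv_eq_lintegral_klKernel hq hp, lintegral_congr_ae
    ((hp.ae_eq_zero_of_ac hq hQP).mono fun a ha =>
      klKernel_symm_eq_weight (hp.nonneg a) (hq.nonneg a) ha),
    lintegral_add_left (measurable_weight (by fun_prop) 1 hp.measurable hq.measurable)]
  congr 1
  · refine (lintegral_tail P Q hb zero_le_one (G := fun t => 1 - (Real.log t + 1) / t)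
      (by fun_prop) ?_ ?_ ?_ (by simp) ?_).symm
    · exact fun x hx => (hasDerivAt_log_add_one_div
        (zero_lt_one.trans_le hx).ne').continuousAt.continuousWithinAt
    · exact fun x hx => hasDerivAt_log_add_one_div (zero_lt_one.trans hx).ne'
    · exact fun x hx => div_nonneg (Real.log_nonneg (le_of_lt hx)) (by positivity)
    · rw [← ENNReal.ofReal_one]
      refine ENNReal.tendsto_ofReal ?_
      have h1 : Tendsto (fun t : ℝ => Real.log t / t) atTop (𝓝 0) :=
        Real.isLittleO_log_id_atTop.tendsto_div_nhds_zero
      have h2 := (h1.add (tendsto_id.const_div_atTop (1 : ℝ))).const_sub 1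
      simpa [add_div] using h2
  · refine (lintegral_head P Q hb (G := fun t => 1 - (Real.log t + 1) / t)
      (by fun_prop) ?_ ?_ (by simp)).symm
    · intro x hx
      rw [neg_neg]
      exact hasDerivAt_log_add_one_div hx.1.ne'
    · intro x hx
      exact neg_nonneg.2 (div_nonpos_of_nonpos_of_nonneg
        (Real.log_nonpos hx.1.le hx.2.le) (by positivity))

lemma spectrumRI_monotone (P Q : Measure A) [IsProbabilityMeasure P] (b : ℝ) : Monotone (spectrumRI b P Q) := fun _ _ h =>
  measureReal_mono fun _ ha => le_trans ha (EReal.coe_le_coe_iff.2 h)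

lemma measurable_spectrumRI_logb (P Q : Measure A) [IsProbabilityMeasure P] (b : ℝ) :
    Measurable fun β => spectrumRI b P Q (Real.logb b β) :=
  (spectrumRI_monotone P Q b).measurable.comp (by unfold Real.logb; fun_prop)

theorem jeffreys_eq {b : ℝ} (hb : 1 < b) (hQP : Q ≪ P) : jeffreys b P Q =
    intOn (Ioi 1) (fun β => (1 - spectrumRI b P Q (Real.logb b β)) *
      (Real.logb b (Real.exp 1) / β + Real.logb b β / β ^ 2)) -
    intOn (Ioo 0 1) (fun β => spectrumRI b P Q (Real.logb b β) *
      (Real.logb b (Real.exp 1) / β + Real.logb b β / β ^ 2)) := by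
  have hlb : 0 < Real.log b := Real.log_pos hb
  have hm := measurable_spectrumRI_logb P Q b
  set F : ℝ → ℝ := fun β => spectrumRI b P Q (Real.logb b β) with hF
  have hF0 (β : ℝ) : 0 ≤ F β := spectrumRI_nonneg P Q b _
  have hF1 (β : ℝ) : 0 ≤ 1 - F β := sub_nonneg.2 (spectrumRI_le_one P Q b _)
  have h1 := klDiv_eq_lintegral_sub P Q hb
  have h2 := klDiv_symm_eq_lintegral_add P Q hb hQP
  -- With D(P‖Q) = a - u and D(Q‖P) = v + w, finiteness of u is what permits regrouping as (a + v) -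
  -- (u - w).
  have hfin : ∫⁻ β in Ioo 0 1, ENNReal.ofReal (β⁻¹ * F β) ≠ ∞ := by
    rw [lintegral_head_inv P Q hb]
    exact ne_top_of_le_ne_top ENNReal.one_ne_top (lintegral_weight_neg_log_le_one P Q)
  have e1 : intOn (Ioi 1) (fun β => (1 - F β) *
      (Real.logb b (Real.exp 1) / β + Real.logb b β / β ^ 2)) =
      (((Real.log b)⁻¹ : ℝ) : EReal) *
        (((∫⁻ β in Ioi 1, ENNReal.ofReal (β⁻¹ * (1 - F β))) +
          ∫⁻ β in Ioi 1, ENNReal.ofReal (Real.log β / β ^ 2 * (1 - F β)) : ℝ≥0∞) : EReal) := by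
    have hpos1 : ∀ β ∈ Ioi (1 : ℝ), 0 ≤ β⁻¹ * (1 - F β) := fun β hβ =>
      mul_nonneg (inv_nonneg.2 (zero_lt_one.trans hβ).le) (hF1 β)
    have hpos2 : ∀ β ∈ Ioi (1 : ℝ), 0 ≤ Real.log β / β ^ 2 * (1 - F β) := fun β hβ =>
      mul_nonneg (div_nonneg (Real.log_nonneg (le_of_lt hβ)) (by positivity)) (hF1 β)
    rw [← lintegral_add_left (by fun_prop), setLIntegral_congr_fun measurableSet_Ioi
      fun β hβ => (ENNReal.ofReal_add (hpos1 β hβ) (hpos2 β hβ)).symm,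
      ← intOn_eq_lintegral measurableSet_Ioi fun β hβ => add_nonneg (hpos1 β hβ) (hpos2 β hβ),
      ← intOn_const_mul (inv_pos.2 hlb)]
    congr 1
    ext β
    simp only [Real.logb, Real.log_exp]
    field_simp
  have e2 : intOn (Ioo 0 1) (fun β => F β *
      (Real.logb b (Real.exp 1) / β + Real.logb b β / β ^ 2)) =
      (((Real.log b)⁻¹ : ℝ) : EReal) *
        (((∫⁻ β in Ioo 0 1, ENNReal.ofReal (β⁻¹ * F β) : ℝ≥0∞) : EReal) -
          ((∫⁻ β in Ioo 0 1, ENNReal.ofReal (-(Real.log β / β ^ 2) * F β) : ℝ≥0∞) : EReal)) := by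
    have hint : Integrable (fun β => β⁻¹ * F β) (volume.restrict (Ioo 0 1)) := by
      refine ⟨(by fun_prop : Measurable fun β => β⁻¹ * F β).aestronglyMeasurable, ?_⟩
      rw [hasFiniteIntegral_iff_ofReal]
      · exact lt_top_iff_ne_top.2 hfin
      · exact (ae_restrict_mem measurableSet_Ioo).mono fun β hβ =>
          mul_nonneg (inv_nonneg.2 hβ.1.le) (hF0 β)
    -- On (0, 1) the two terms have opposite signs and only the β⁻¹ term is known to be integrable,
    -- so the negated integrand is treated.
    have h3 := extIntegral_eq_lintegral_add (μ := volume.restrict (Ioo (0 : ℝ) 1))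
      (X := fun β => -(((β⁻¹ + Real.log β / β ^ 2) * F β : ℝ) : EReal))
      (Y := fun β => ENNReal.ofReal (-(Real.log β / β ^ 2) * F β))
      (Z := fun β => -(β⁻¹ * F β)) (by fun_prop) (by fun_prop) hint.neg ?_
    · have h4 : ∫⁻ β in Ioo (0 : ℝ) 1,
          (- -(((β⁻¹ + Real.log β / β ^ 2) * F β : ℝ) : EReal)).toENNReal ≠ ∞ := by
        refine ne_top_of_le_ne_top hfin (setLIntegral_mono (by fun_prop) fun β hβ => ?_)
        rw [neg_neg, EReal.real_coe_toENNReal]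
        refine ENNReal.ofReal_le_ofReal (mul_le_mul_of_nonneg_right ?_ (hF0 β))
        have : Real.log β / β ^ 2 ≤ 0 := div_nonpos_of_nonpos_of_nonneg
          (Real.log_nonpos hβ.1.le hβ.2.le) (by positivity)
        linarith
      have h5 := extIntegral_neg_of_ne_top h4
      simp only [neg_neg] at h5
      rw [h3, integral_neg, integral_eq_lintegral_of_nonneg_ae _ hint.1,
        EReal.neg_add (Or.inl (EReal.coe_ennreal_ne_bot _)) (Or.inr (EReal.coe_ne_bot _)),
        EReal.coe_neg, sub_eq_add_neg, neg_neg, add_comm, ← sub_eq_add_neg,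
        EReal.coe_ennreal_toReal hfin] at h5
      · rw [← h5]
        change _ = _ * intOn (Ioo 0 1) _
        rw [← intOn_const_mul (inv_pos.2 hlb)]
        congr 1
        ext β
        simp only [Real.logb, Real.log_exp]
        field_simp
      · exact (ae_restrict_mem measurableSet_Ioo).mono fun β hβ =>
          mul_nonneg (inv_nonneg.2 hβ.1.le) (hF0 β)
    · filter_upwards [ae_restrict_mem measurableSet_Ioo] with β hβ
      have : 0 ≤ -(Real.log β / β ^ 2) * F β := mul_nonneg (neg_nonneg.2
        (div_nonpos_of_nonpos_of_nonneg (Real.log_nonpos hβ.1.le hβ.2.le) (by positivity))) (hF0 β)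
      rw [EReal.coe_ennreal_ofReal, max_eq_left this, ← EReal.coe_neg, ← EReal.coe_add]
      congr 1
      ring
  change _ = intOn (Ioi 1) (fun β => (1 - F β) *
      (Real.logb b (Real.exp 1) / β + Real.logb b β / β ^ 2)) - intOn (Ioo 0 1) (fun β => F β *
      (Real.logb b (Real.exp 1) / β + Real.logb b β / β ^ 2))
  rw [e1, e2, ← coe_mul_sub (inv_pos.2 hlb).le, jeffreys, relEntropy, relEntropy,
    h1, h2, EReal.coe_ennreal_add, EReal.coe_ennreal_add, sub_eq_add_neg, sub_eq_add_neg,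
    EReal.neg_sub (Or.inl (EReal.coe_ennreal_ne_bot _)) (Or.inl (by simpa using hfin)),
    add_add_add_comm, EReal.coe_inv,
    EReal.left_distrib_of_nonneg_of_ne_top (by
      rw [← EReal.coe_inv]; exact_mod_cast (inv_pos.2 hlb).le)
      (by rw [← EReal.coe_inv]; exact EReal.coe_ne_top _),
    EReal.div_eq_inv_mul, EReal.div_eq_inv_mul]

end Jeffreys

/-! ### Lin's measure and the Jensen–Shannon divergence -/

section Lin

open InformationTheory

/-- The primitive of `-log (1 + c t) / t²` which vanishes at `∞`. -/
noncomputable def linPrimitive (c t : ℝ) : ℝ :=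
  Real.log (1 + c * t) / t + c * (Real.log (1 + c * t) - Real.log (c * t))

lemma measurable_linPrimitive (c : ℝ) : Measurable (linPrimitive c) := by
  unfold linPrimitive
  fun_prop

lemma hasDerivAt_linPrimitive {c t : ℝ} (hc : 0 < c) (ht : 0 < t) :
    HasDerivAt (linPrimitive c) (-(Real.log (1 + c * t) / t ^ 2)) t := by
  have h1 : HasDerivAt (fun t => c * t) c t := by simpa using (hasDerivAt_id t).const_mul c
  have hpos : 0 < 1 + c * t := by positivity
  have h2 := (h1.const_add 1).log hpos.ne'
  have h3 := h1.log (by positivity)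
  have := (h2.div (hasDerivAt_id t) ht.ne').add ((h2.sub h3).const_mul c)
  refine this.congr_deriv ?_
  simp only [id]
  field_simp
  ring

lemma tendsto_linPrimitive {c : ℝ} (hc : 0 < c) : Tendsto (linPrimitive c) atTop (𝓝 0) := by
  have hct : Tendsto (fun t : ℝ => c * t) atTop atTop := tendsto_id.const_mul_atTop hc
  have hct' : Tendsto (fun t : ℝ => 1 + c * t) atTop atTop :=
    tendsto_atTop_add_const_left _ 1 hct
  have h0 : Tendsto (fun t : ℝ => 1 + (c * t)⁻¹) atTop (𝓝 1) := by
    simpa using (tendsto_inv_atTop_zero.comp hct).const_add 1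
  have h1 : Tendsto (fun t : ℝ => Real.log (1 + (c * t)⁻¹)) atTop (𝓝 0) := by
    simpa using h0.log one_ne_zero
  have h2 : Tendsto (fun t : ℝ => Real.log (1 + c * t) / (1 + c * t)) atTop (𝓝 0) :=
    Real.isLittleO_log_id_atTop.tendsto_div_nhds_zero.comp hct'
  -- The primitive is rewritten as c (1 + 1/(ct)) log(1+ct)/(1+ct) + c log(1 + 1/(ct)).
  have h3 := (h2.mul (h0.const_mul c)).add (h1.const_mul c)
  simp only [zero_mul, mul_zero, add_zero] at h3
  refine h3.congr' ?_
  filter_upwards [eventually_gt_atTop 0] with t ht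
  have hpos : 0 < 1 + c * t := by positivity
  rw [linPrimitive, ← Real.log_div hpos.ne' (by positivity)]
  have e : 1 + (c * t)⁻¹ = (1 + c * t) / (c * t) := by
    field_simp
    ring
  rw [e]
  congr 1
  field_simp

lemma linPrimitive_nonneg {c t : ℝ} (hc : 0 < c) (ht : 0 < t) : 0 ≤ linPrimitive c t := by
  unfold linPrimitive
  have hct : 0 < c * t := mul_pos hc ht
  have h1 : Real.log (c * t) ≤ Real.log (1 + c * t) := Real.log_le_log hct (by linarith)
  have h2 : 0 ≤ Real.log (1 + c * t) := Real.log_nonneg (by linarith)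
  exact add_nonneg (div_nonneg h2 ht.le) (mul_nonneg hc.le (sub_nonneg.2 h1))

/-- The pointwise identity behind the integral representation of Lin's measure. -/
lemma lin_kernel_identity {θ : ℝ} (h0 : 0 < θ) (h1 : θ < 1) {x y : ℝ} (hx : 0 ≤ x) (hy : 0 ≤ y) :
    ENNReal.ofReal θ * klKernel x (θ * x + (1 - θ) * y) +
      ENNReal.ofReal (1 - θ) * klKernel y (θ * x + (1 - θ) * y) +
      ENNReal.ofReal (1 - θ) * weight (linPrimitive (θ / (1 - θ))) 0 x y =
    ENNReal.ofReal (Real.negMulLog θ) * ENNReal.ofReal x +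
      ENNReal.ofReal (Real.negMulLog (1 - θ)) * ENNReal.ofReal y := by
  have h1' : 0 < 1 - θ := sub_pos.2 h1
  have hn1 : 0 ≤ Real.negMulLog θ := Real.negMulLog_nonneg h0.le h1.le
  have hn2 : 0 ≤ Real.negMulLog (1 - θ) := Real.negMulLog_nonneg h1'.le (by linarith)
  rcases hx.eq_or_lt with rfl | hx
  · rcases hy.eq_or_lt with rfl | hy
    · simp [klKernel, weight_zero_left]
    · have hm : 0 < (1 - θ) * y := mul_pos h1' hy
      have hnn := mul_log_div_add_sub_nonneg hy hm
      have e : y / ((1 - θ) * y) = (1 - θ)⁻¹ := by field_simp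
      simp only [mul_zero, zero_add]
      rw [klKernel_zero_left hm.le, klKernel_of_pos y hm, weight_zero_left,
        ← ENNReal.ofReal_mul h0.le, ← ENNReal.ofReal_mul h1'.le,
        ← ENNReal.ofReal_add (by positivity) (mul_nonneg h1'.le hnn), e, Real.log_inv]
      simp only [mul_zero, add_zero, ENNReal.ofReal_zero, zero_add]
      rw [← ENNReal.ofReal_mul hn2]
      congr 1
      unfold Real.negMulLog
      ring
  rcases hy.eq_or_lt with rfl | hy
  · have hm : 0 < θ * x := mul_pos h0 hx
    have hnn := mul_log_div_add_sub_nonneg hx hm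
    have e : x / (θ * x) = θ⁻¹ := by field_simp
    simp only [mul_zero, add_zero]
    rw [klKernel_zero_left hm.le, klKernel_of_pos x hm, weight_zero_right,
      ← ENNReal.ofReal_mul h0.le, ← ENNReal.ofReal_mul h1'.le,
      ← ENNReal.ofReal_add (mul_nonneg h0.le hnn) (by positivity), e, Real.log_inv]
    simp only [mul_zero, add_zero, ENNReal.ofReal_zero]
    rw [← ENNReal.ofReal_mul hn1]
    congr 1
    unfold Real.negMulLog
    ring
  -- With m = θx + (1-θ)y, the weighted linear corrections in the two kernels cancel, and the weight
  -- term equals (1-θ)y log(m/((1-θ)y)) + θx log(m/(θx)). All logarithms of x, y and m cancel,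
  -- leaving the entropy terms.
  · have hm : 0 < θ * x + (1 - θ) * y := by positivity
    have hc : 0 < θ / (1 - θ) := div_pos h0 h1'
    have hG := mul_nonneg hx.le (linPrimitive_nonneg hc (div_pos hx hy))
    have hn3 := mul_log_div_add_sub_nonneg hx hm
    have hn4 := mul_log_div_add_sub_nonneg hy hm
    rw [klKernel_of_pos x hm, klKernel_of_pos y hm, weight_of_pos hx hy,
      ← ENNReal.ofReal_mul h0.le, ← ENNReal.ofReal_mul h1'.le, ← ENNReal.ofReal_mul h1'.le,
      ← ENNReal.ofReal_mul hn1, ← ENNReal.ofReal_mul hn2,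
      ← ENNReal.ofReal_add (mul_nonneg h0.le hn3) (mul_nonneg h1'.le hn4),
      ← ENNReal.ofReal_add (by positivity) (mul_nonneg h1'.le hG),
      ← ENNReal.ofReal_add (by positivity) (by positivity)]
    congr 1
    have e1 : 1 + θ / (1 - θ) * (x / y) = (θ * x + (1 - θ) * y) / ((1 - θ) * y) := by
      field_simp
      ring
    have e2 : θ / (1 - θ) * (x / y) = (θ * x) / ((1 - θ) * y) := by
      field_simp
    have hty : (1 - θ) * y ≠ 0 := by positivity
    have htx : θ * x ≠ 0 := by positivity
    rw [linPrimitive, e1, e2, Real.log_div hm.ne' hty, Real.log_div htx hty,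
      Real.log_div hx.ne' hm.ne', Real.log_div hy.ne' hm.ne', Real.log_mul h0.ne' hx.ne',
      Real.log_mul h1'.ne' hy.ne']
    unfold Real.negMulLog
    field_simp
    ring

variable {A : Type*} [MeasurableSpace A] (P Q : Measure A)

lemma isDensity_mixture {μ : Measure A} {p q : A → ℝ} (hp : IsDensity P μ p)
    (hq : IsDensity Q μ q) {θ : ℝ} (h0 : 0 ≤ θ) (h1 : θ ≤ 1) :
    IsDensity (mixture θ P Q) μ fun a => θ * p a + (1 - θ) * q a where
  measurable := (hp.measurable.const_mul θ).add (hq.measurable.const_mul (1 - θ))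
  nonneg a := add_nonneg (mul_nonneg h0 (hp.nonneg a)) (mul_nonneg (sub_nonneg.2 h1) (hq.nonneg a))
  eq_withDensity := by
    rw [mixture, hp.eq_withDensity, hq.eq_withDensity,
      ← withDensity_smul _ hp.measurable_ofReal, ← withDensity_smul _ hq.measurable_ofReal,
      ← withDensity_add_left (hp.measurable_ofReal.const_smul _)]
    congr 1
    ext a
    simp only [Pi.add_apply, Pi.smul_apply, smul_eq_mul]
    rw [ENNReal.ofReal_add (mul_nonneg h0 (hp.nonneg a))
      (mul_nonneg (sub_nonneg.2 h1) (hq.nonneg a)), ENNReal.ofReal_mul h0,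
      ENNReal.ofReal_mul (sub_nonneg.2 h1)]

instance isFiniteMeasure_mixture [IsFiniteMeasure P] [IsFiniteMeasure Q] (θ : ℝ) :
    IsFiniteMeasure (mixture θ P Q) := by
  unfold mixture
  have h1 := Measure.smul_finite P (ENNReal.ofReal_ne_top (r := θ))
  have h2 := Measure.smul_finite Q (ENNReal.ofReal_ne_top (r := 1 - θ))
  infer_instance

variable [IsProbabilityMeasure P] [IsProbabilityMeasure Q]

lemma relEntropy_self (b : ℝ) : relEntropy b P P = 0 := by
  simp [relEntropy]

lemma lin_eq_of_pos_of_lt_one {b : ℝ} (hb : 1 < b) {θ : ℝ} (h0 : 0 < θ) (h1 : θ < 1) :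
    lin b θ P Q = ((Real.binEntropy θ / Real.log b : ℝ) : EReal) - ((1 - θ : ℝ) : EReal) *
      intOn (Ioi 0) (fun β => Real.logb b (1 + θ * β / (1 - θ)) / β ^ 2 *
        spectrumRI b P Q (Real.logb b β)) := by
  have hlb : 0 < Real.log b := Real.log_pos hb
  have h1' : 0 < 1 - θ := sub_pos.2 h1
  have hc : 0 < θ / (1 - θ) := div_pos h0 h1'
  have hp := isDensity₁ P Q
  have hq := isDensity₂ P Q
  have hm := isDensity_mixture P Q hp hq h0.le h1.le
  have hn1 : 0 ≤ Real.negMulLog θ := Real.negMulLog_nonneg h0.le h1.le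
  have hn2 : 0 ≤ Real.negMulLog (1 - θ) := Real.negMulLog_nonneg h1'.le (by linarith)
  set I := ∫⁻ a, weight (linPrimitive (θ / (1 - θ))) 0 (dens₁ P Q a) (dens₂ P Q a) ∂(P + Q)
    with hI
  have hint : intOn (Ioi 0) (fun β => Real.logb b (1 + θ * β / (1 - θ)) / β ^ 2 *
      spectrumRI b P Q (Real.logb b β)) = (((Real.log b)⁻¹ : ℝ) : EReal) * (I : EReal) := by
    have := intOn_halfLine P Q hb (g := fun β => Real.log (1 + θ / (1 - θ) * β) / β ^ 2)
      (by fun_prop) (fun x hx => hasDerivAt_linPrimitive hc hx) (fun x hx => ?_)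
      (tendsto_linPrimitive hc)
    · rw [hI, ← this, ← intOn_const_mul (inv_pos.2 hlb)]
      congr 1
      ext β
      rw [Real.logb, show θ * β / (1 - θ) = θ / (1 - θ) * β by ring]
      ring
    · have : 0 < θ / (1 - θ) * x := mul_pos hc hx
      exact div_nonneg (Real.log_nonneg (by linarith)) (by positivity)
  have hsum : ENNReal.ofReal θ * klDiv P (mixture θ P Q) +
      ENNReal.ofReal (1 - θ) * klDiv Q (mixture θ P Q) + ENNReal.ofReal (1 - θ) * I =
      ENNReal.ofReal (Real.binEntropy θ) := by
    rw [klDiv_eq_lintegral_klKernel hp hm, klDiv_eq_lintegral_klKernel hq hm, hI,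
      ← lintegral_const_mul' _ _ ENNReal.ofReal_ne_top,
      ← lintegral_const_mul' _ _ ENNReal.ofReal_ne_top,
      ← lintegral_const_mul' _ _ ENNReal.ofReal_ne_top,
      ← lintegral_add_left ((measurable_klKernel hp.measurable hm.measurable).const_mul _),
      ← lintegral_add_right _ ((measurable_weight (measurable_linPrimitive _) 0 hp.measurable
        hq.measurable).const_mul _),
      lintegral_congr fun a => lin_kernel_identity h0 h1 (hp.nonneg a) (hq.nonneg a),
      lintegral_add_left (hp.measurable_ofReal.const_mul _),
      lintegral_const_mul' _ _ ENNReal.ofReal_ne_top,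
      lintegral_const_mul' _ _ ENNReal.ofReal_ne_top, hp.lintegral_eq_one,
      hq.lintegral_eq_one, mul_one, mul_one, ← ENNReal.ofReal_add hn1 hn2,
      Real.binEntropy_eq_negMulLog_add_negMulLog_one_sub]
  -- The total is the finite number h(θ), so every summand is finite and the identity passes to the
  -- reals.
  have hne : ENNReal.ofReal θ * klDiv P (mixture θ P Q) +
      ENNReal.ofReal (1 - θ) * klDiv Q (mixture θ P Q) + ENNReal.ofReal (1 - θ) * I ≠ ∞ :=
    hsum ▸ ENNReal.ofReal_ne_top
  have hθ : ENNReal.ofReal θ ≠ 0 := by simpa using h0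
  have hθ' : ENNReal.ofReal (1 - θ) ≠ 0 := by simpa using h1
  simp only [ne_eq, ENNReal.add_eq_top, not_or] at hne
  have hfin {c x : ℝ≥0∞} (hc : c ≠ 0) (h : ¬c * x = ∞) : x ≠ ∞ := by
    rintro rfl
    exact h (ENNReal.mul_top hc)
  have f1 := hfin hθ hne.1.1
  have f2 := hfin hθ' hne.1.2
  have f3 := hfin hθ' hne.2
  have hreal := congrArg ENNReal.toReal hsum
  rw [ENNReal.toReal_add (by finiteness) (by finiteness),
    ENNReal.toReal_add (by finiteness) (by finiteness), ENNReal.toReal_mul, ENNReal.toReal_mul,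
    ENNReal.toReal_mul, ENNReal.toReal_ofReal h0.le, ENNReal.toReal_ofReal h1'.le,
    ENNReal.toReal_ofReal (Real.binEntropy_nonneg h0.le h1.le)] at hreal
  rw [hint, lin, relEntropy, relEntropy, ← EReal.coe_ennreal_toReal f1,
    ← EReal.coe_ennreal_toReal f2, ← EReal.coe_ennreal_toReal f3, ← hreal,
    ← EReal.coe_div, ← EReal.coe_div, ← EReal.coe_mul, ← EReal.coe_mul, ← EReal.coe_mul,
    ← EReal.coe_mul, ← EReal.coe_add, ← EReal.coe_sub]
  congr 1
  field_simp
  ring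

theorem lin_eq {b : ℝ} (hb : 1 < b) {θ : ℝ} (h0 : 0 ≤ θ) (h1 : θ ≤ 1) :
    lin b θ P Q = ((Real.binEntropy θ / Real.log b : ℝ) : EReal) - ((1 - θ : ℝ) : EReal) *
      intOn (Ioi 0) (fun β => Real.logb b (1 + θ * β / (1 - θ)) / β ^ 2 *
        spectrumRI b P Q (Real.logb b β)) := by
  rcases h0.eq_or_lt with rfl | h0
  · have h : mixture 0 P Q = Q := by simp [mixture]
    simp [lin, h, relEntropy_self, intOn, extIntegral]
  -- At θ = 1 the prefactor 1 - θ annihilates the integral term, whatever the junk value of the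
  -- division by 0.
  rcases h1.eq_or_lt with rfl | h1
  · have h : mixture 1 P Q = P := by simp [mixture]
    simp [lin, h, relEntropy_self]
  exact lin_eq_of_pos_of_lt_one P Q hb h0 h1

theorem jensenShannon_eq {b : ℝ} (hb : 1 < b) :
    jensenShannon b P Q = ((Real.logb b 2 : ℝ) : EReal) -
      intOn (Ioi 0) (fun β => Real.logb b (β + 1) / (2 * β ^ 2) *
        spectrumRI b P Q (Real.logb b β)) := by
  rw [jensenShannon, lin_eq P Q hb (by norm_num) (by norm_num),
    ← intOn_const_mul (by norm_num), one_div, Real.binEntropy_two_inv]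
  congr 2
  ext β
  rw [show 1 + 2⁻¹ * β / (1 - 2⁻¹) = β + 1 by ring]
  ring

end Lin

/-! ### Logarithmic transforms: Bhattacharyya and Rényi -/

section Transforms

lemma elogb_mul {b : ℝ} (hb : 1 < b) (x y : ℝ≥0∞) :
    elogb b (x * y) = elogb b x + elogb b y := by
  have h : (0 : ℝ) ≤ (Real.log b)⁻¹ := (inv_pos.2 (Real.log_pos hb)).le
  simp only [elogb, ENNReal.log_mul_add, EReal.div_eq_inv_mul, ← EReal.coe_inv]
  exact EReal.left_distrib_of_nonneg_of_ne_top (by exact_mod_cast h) (EReal.coe_ne_top _) _ _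

lemma elogb_inv (b : ℝ) (x : ℝ≥0∞) : elogb b x⁻¹ = -elogb b x := by
  rw [elogb, elogb, ENNReal.log_inv, div_eq_mul_inv, div_eq_mul_inv, EReal.neg_mul]

lemma elogb_ofReal (b : ℝ) {x : ℝ} (hx : 0 < x) : elogb b (ENNReal.ofReal x) = Real.logb b x := by
  rw [elogb, ENNReal.log_ofReal_of_pos hx, Real.logb, EReal.coe_div]

variable {A : Type*} [MeasurableSpace A] (P Q : Measure A) [IsProbabilityMeasure P]
  [IsProbabilityMeasure Q]

lemma intOn_spectrum_nonneg (P Q : Measure A) (b α : ℝ) :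
    0 ≤ intOn (Ioi 0) (fun β => β ^ α * spectrumRI b P Q (Real.logb b β)) := by
  rw [intOn_eq_lintegral measurableSet_Ioi fun β hβ => mul_nonneg
    (Real.rpow_nonneg (le_of_lt hβ) _) (spectrumRI_nonneg P Q b _)]
  exact EReal.coe_ennreal_nonneg _

lemma intOn_one_sub_spectrum_nonneg (P Q : Measure A) [IsProbabilityMeasure P] (b α : ℝ) :
    0 ≤ intOn (Ioi 0) (fun β => β ^ α * (1 - spectrumRI b P Q (Real.logb b β))) := by
  rw [intOn_eq_lintegral measurableSet_Ioi fun β hβ => mul_nonneg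
    (Real.rpow_nonneg (le_of_lt hβ) _) (sub_nonneg.2 (spectrumRI_le_one P Q b _))]
  exact EReal.coe_ennreal_nonneg _

theorem sqHellinger_eq {b : ℝ} (hb : 1 < b) : sqHellinger P Q = 1 - ((1 / 2 : ℝ) : EReal) *
    intOn (Ioi 0) (fun β => β ^ (-(3 / 2) : ℝ) * spectrumRI b P Q (Real.logb b β)) := by
  rw [sqHellinger, hellinger_eq_of_lt_one P Q hb (by norm_num) (by norm_num),
    coe_mul_sub (by norm_num), ← EReal.coe_mul]
  norm_num

/-- Includes I = ∞, where 1 - (1 - ∞) = ∞, so the finiteness of the Hellinger integral need not be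
proved. -/
lemma one_sub_one_sub_mul {I : EReal} (hI : 0 ≤ I) {c : ℝ} (hc : 0 < c) :
    1 - (1 - (c : EReal) * I) = c * I := by
  induction I with
  | bot => simp at hI
  | top =>
    rw [EReal.coe_mul_top_of_pos hc, EReal.sub_top]
    exact EReal.coe_sub_bot 1
  | coe i =>
    rw [← EReal.coe_mul, ← EReal.coe_one, ← EReal.coe_sub, ← EReal.coe_sub, sub_sub_cancel]

theorem bhattacharyya_eq {b : ℝ} (hb : 1 < b) : bhattacharyya b P Q =
    ((Real.logb b 2 : ℝ) : EReal) - elogb b (intOn (Ioi 0) (fun β => β ^ (-(3 / 2) : ℝ) *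
      spectrumRI b P Q (Real.logb b β))).toENNReal := by
  have hI := intOn_spectrum_nonneg P Q b (-(3 / 2))
  rw [bhattacharyya, sqHellinger_eq P Q hb, one_sub_one_sub_mul hI (by norm_num), elogb_inv,
    EReal.toENNReal_mul (by exact_mod_cast (by norm_num : (0 : ℝ) ≤ 1 / 2)),
    EReal.real_coe_toENNReal, elogb_mul hb, elogb_ofReal b (by norm_num),
    EReal.neg_add (Or.inl (EReal.coe_ne_bot _)) (Or.inl (EReal.coe_ne_top _)), ← EReal.coe_neg,
    one_div, Real.logb_inv, neg_neg]

theorem renyi_eq_of_lt_one {b : ℝ} (hb : 1 < b) {α : ℝ} (h0 : 0 < α) (h1 : α < 1) :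
    renyi b α P Q = ((1 / (α - 1) : ℝ) : EReal) * elogb b (((1 - α : ℝ) : EReal) *
      intOn (Ioi 0) (fun β => β ^ (α - 2) * spectrumRI b P Q (Real.logb b β))).toENNReal := by
  have hI := intOn_spectrum_nonneg P Q b (α - 2)
  rw [renyi, hellinger_eq_of_lt_one P Q hb h0 h1]
  generalize intOn (Ioi 0) (fun β => β ^ (α - 2) * spectrumRI b P Q (Real.logb b β)) = I at hI
  -- What remains is that the constant 1 cancels against (α-1)/(1-α) = -1; this is checked also for
  -- an infinite integral.
  congr 3
  have hα : 0 < 1 - α := by linarith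
  induction I with
  | bot => simp at hI
  | top =>
    rw [EReal.sub_top, EReal.coe_mul_bot_of_neg (by linarith), EReal.coe_mul_top_of_pos hα]
    exact EReal.coe_add_top 1
  | coe i =>
    rw [← EReal.coe_sub, ← EReal.coe_mul, ← EReal.coe_mul, ← EReal.coe_one, ← EReal.coe_add]
    congr 1
    field_simp
    ring

theorem renyi_eq_of_one_lt {b : ℝ} (hb : 1 < b) {α : ℝ} (h1 : 1 < α) :
    renyi b α P Q = ((1 / (α - 1) : ℝ) : EReal) * elogb b (((α - 1 : ℝ) : EReal) *
      intOn (Ioi 0) (fun β => β ^ (α - 2) *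
        (1 - spectrumRI b P Q (Real.logb b β)))).toENNReal := by
  have hI := intOn_one_sub_spectrum_nonneg P Q b (α - 2)
  rw [renyi, hellinger_eq_of_one_lt P Q hb h1]
  generalize intOn (Ioi 0) (fun β => β ^ (α - 2) *
    (1 - spectrumRI b P Q (Real.logb b β))) = I at hI
  congr 3
  have hα : 0 < α - 1 := by linarith
  induction I with
  | bot => simp at hI
  | top =>
    rw [EReal.top_sub_coe, EReal.coe_mul_top_of_pos hα]
    exact EReal.coe_add_top 1
  | coe i =>
    rw [← EReal.coe_sub, ← EReal.coe_mul, ← EReal.coe_mul, ← EReal.coe_one, ← EReal.coe_add]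
    congr 1
    field_simp
    ring

end Transforms

end RelInfo

/-! ### The collected identities -/

theorem theorem2 {A : Type*} [MeasurableSpace A] (P Q : Measure A)
    [IsProbabilityMeasure P] [IsProbabilityMeasure Q] (b : ℝ) (hb : 1 < b)
    (F : ℝ → ℝ) (hF : F = spectrumRI b P Q) :
    -- relative entropy
    (((1 / Real.logb b (Real.exp 1) : ℝ) : EReal) * relEntropy b P Q =
      intOn (Ioi 1) (fun β => (1 - F (Real.logb b β)) / β) -
        intOn (Ioo 0 1) (fun β => F (Real.logb b β) / β)) ∧
    -- Hellinger divergence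
    (∀ α : ℝ, 0 < α → α < 1 → hellinger α P Q =
      ((1 / (1 - α) : ℝ) : EReal) -
        intOn (Ioi 0) (fun β => β ^ (α - 2) * F (Real.logb b β))) ∧
    (∀ α : ℝ, 1 < α → hellinger α P Q =
      intOn (Ioi 0) (fun β => β ^ (α - 2) * (1 - F (Real.logb b β))) -
        ((1 / (α - 1) : ℝ) : EReal)) ∧
    -- chi-squared divergence, squared Hellinger distance, Bhattacharyya distance
    (chiSq P Q = intOn (Ioi 0) (fun β => 1 - F (Real.logb b β)) - 1) ∧
    (sqHellinger P Q = 1 - ((1 / 2 : ℝ) : EReal) *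
      intOn (Ioi 0) (fun β => β ^ (-(3 / 2) : ℝ) * F (Real.logb b β))) ∧
    (bhattacharyya b P Q = ((Real.logb b 2 : ℝ) : EReal) -
      elogb b (intOn (Ioi 0) (fun β => β ^ (-(3 / 2) : ℝ) * F (Real.logb b β))).toENNReal) ∧
    -- Rényi divergence
    (∀ α : ℝ, 0 < α → α < 1 → renyi b α P Q =
      ((1 / (α - 1) : ℝ) : EReal) * elogb b (((1 - α : ℝ) : EReal) *
        intOn (Ioi 0) (fun β => β ^ (α - 2) * F (Real.logb b β))).toENNReal) ∧
    (∀ α : ℝ, 1 < α → renyi b α P Q =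
      ((1 / (α - 1) : ℝ) : EReal) * elogb b (((α - 1 : ℝ) : EReal) *
        intOn (Ioi 0) (fun β => β ^ (α - 2) * (1 - F (Real.logb b β)))).toENNReal) ∧
    -- chi^s divergence
    (Q ≪ P → ∀ s : ℝ, 1 ≤ s → chiPow s P Q =
      intOn (Ioi 1) (fun β =>
        1 / β * (s - 1 + 1 / β) * (β - 1) ^ (s - 1) * (1 - F (Real.logb b β))) +
      intOn (Ioo 0 1) (fun β =>
        1 / β * (s - 1 + 1 / β) * (1 - β) ^ (s - 1) * F (Real.logb b β))) ∧
    -- total variation distance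
    (tvDist P Q = 2 * intOn (Ioi 1) (fun β => (1 - F (Real.logb b β)) / β ^ 2)) ∧
    (Q ≪ P → tvDist P Q = 2 * intOn (Ioo 0 1) (fun β => F (Real.logb b β) / β ^ 2)) ∧
    -- DeGroot statistical information
    (Q ≪ P → ∀ w : ℝ, 1 / 2 < w → w < 1 → deGroot w P Q =
      ((1 - w : ℝ) : EReal) *
        intOn (Ioo 0 ((1 - w) / w)) (fun β => F (Real.logb b β) / β ^ 2)) ∧
    (∀ w : ℝ, 0 < w → w ≤ 1 / 2 → deGroot w P Q =
      ((1 - w : ℝ) : EReal) *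
        intOn (Ioi ((1 - w) / w)) (fun β => (1 - F (Real.logb b β)) / β ^ 2)) ∧
    -- triangular discrimination
    (triangular P Q =
      4 * intOn (Ioi 0) (fun β => (1 - F (Real.logb b β)) / (β + 1) ^ 2) - 2) ∧
    -- Lin's measure
    (∀ θ : ℝ, 0 ≤ θ → θ ≤ 1 → lin b θ P Q =
      ((Real.binEntropy θ / Real.log b : ℝ) : EReal) - ((1 - θ : ℝ) : EReal) *
        intOn (Ioi 0) (fun β =>
          Real.logb b (1 + θ * β / (1 - θ)) / β ^ 2 * F (Real.logb b β))) ∧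
    -- Jensen-Shannon divergence
    (jensenShannon b P Q = ((Real.logb b 2 : ℝ) : EReal) -
      intOn (Ioi 0) (fun β => Real.logb b (β + 1) / (2 * β ^ 2) * F (Real.logb b β))) ∧
    -- Jeffreys' divergence
    (Q ≪ P → jeffreys b P Q =
      intOn (Ioi 1) (fun β => (1 - F (Real.logb b β)) *
        (Real.logb b (Real.exp 1) / β + Real.logb b β / β ^ 2)) -
      intOn (Ioo 0 1) (fun β => F (Real.logb b β) *
        (Real.logb b (Real.exp 1) / β + Real.logb b β / β ^ 2))) ∧
    -- E_γ divergence
    (∀ γ : ℝ, 1 ≤ γ → ((eGamma γ P Q : ℝ) : EReal) =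
      (γ : EReal) * intOn (Ioi γ) (fun β => (1 - F (Real.logb b β)) / β ^ 2)) := by
  subst hF
  exact ⟨relEntropy_eq P Q hb, fun _ h0 h1 => hellinger_eq_of_lt_one P Q hb h0 h1,
    fun _ h1 => hellinger_eq_of_one_lt P Q hb h1, chiSq_eq P Q hb, sqHellinger_eq P Q hb,
    bhattacharyya_eq P Q hb, fun _ h0 h1 => renyi_eq_of_lt_one P Q hb h0 h1,
    fun _ h1 => renyi_eq_of_one_lt P Q hb h1, fun hQP _ hs => chiPow_eq P Q hb hQP hs,
    tvDist_eq_tail P Q hb, tvDist_eq_head P Q hb,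
    fun hQP _ hw hw1 => deGroot_eq_head P Q hb hQP hw hw1,
    fun _ hw0 hw => deGroot_eq_tail P Q hb hw0 hw, triangular_eq P Q hb,
    fun _ h0 h1 => lin_eq P Q hb h0 h1, jensenShannon_eq P Q hb, jeffreys_eq P Q hb,
    fun _ hγ => eGamma_eq P Q hb hγ⟩
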